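/- Let $n\ge 0$ and let $\mathbf{Z}[q_{ij}]$ be the polynomial ring in indeterminates $q_{ij}=q_{ji}$, $1\le i<j\le n$. Let $\mathcal{E}_n^{\mathbf q}\langle R\rangle[t]$ be the associative unital $\mathbf{Z}[q_{ij}]$-algebra generated by symbols $[i,j]$ ($1\le i,j\le n$, $i\ne j$), $x_1,\ldots,x_n$ and $t$, where $x_1,\dots,x_n,t$ commute with one another, subject to the relations - $[i,j]=-[j,i]$; - $[i,j]^2=q_{ij}$; - $[i,j][k,l]=[k,l][i,j]$ if $\{i,j\}\cap\{k,l\}=\emptyset$; - $[i,j][j,k]+[j,k][k,i]+[k,i][i,j]=0$ for distinct $i,j,k$; - $[i,j]x_k=x_k[i,j]$ for $k\ne i,j$; - $[i,j]x_i=x_j[i,j]+t$ and $[i,j]x_j=x_i[i,j]-t$ for $i<j$; - $[i,j]t=t[i,j]$. The Dunkl elements $\theta_i=x_i+\sum_{j\ne i}[i,j]$ ($1\le i\le n$) commute pairwise. The quantum elementary polynomials $e_k^{\mathbf q}(X_i\mid i\in I)\in \mathbf{Z}[q_{ij}][X_1,\ldots,X_n]$, $I\subset\{1,\ldots,n\}$,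 are defined by $e_0^{\mathbf q}=1$, $e_k^{\mathbf q}=0$ for $k<0$, $e_k^{\mathbf q}(\emptyset)=0$ for $k>0$, and, for $j\notin I$ and $k>0$, $$e_k^{\mathbf q}(X_i\mid i\in I\cup\{j\})=e_k^{\mathbf q}(X_i\mid i\in I)+X_j\,e_{k-1}^{\mathbf q}(X_i\mid i\in I)+\sum_{a\in I}q_{aj}\,e_{k-2}^{\mathbf q}(X_i\mid i\in I\setminus\{a\}).$$ **Theorem 4.1** (quantum Pieri formula). For all integers $0\le k\le m\le n$, the following identity holds in $\mathcal{E}_n^{\mathbf q}\langle R\rangle[t]$: $$e_k^{\mathbf q}(\theta_1,\ldots,\theta_m)=\sum_{r\ge 0}(-t)^r\,N(m-k,2r)\sum_{S,(i_a),(j_a)}X_S\,[i_1,j_1]\cdots[i_l,j_l],$$ where $N(a,2b)=(2b-1)!!\binom{a+2b}{2b}$ (with $(-1)!!=1$), $X_S=\prod_{s\in S}x_s$, and the inner sum runs over all subsets $S\subset\{1,\ldots,m\}$ and all pairs of sequences $(i_1,\ldots,i_l)$, $(j_1,\ldots,j_l)$ with $l=k-2r-|S|\ge 0$ such that $i_1,\ldots,i_l$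 are distinct elements of $\{1,\ldots,m\}\setminus S$, $m<j_a\le n$ for all $a$, and $j_1\le\cdots\le j_l$. -/

import Mathlib

namespace QuantumPieri

section Polynomials

variable {ι K : Type*} [LinearOrder ι] [CommRing K]

/-- The quantum elementary polynomial `e_k^q(X_i | i ∈ I)`, computed by splitting off the largest
index of `I` in the recursion
`e_k(I ∪ {j}) = e_k(I) + X_j e_{k-1}(I) + ∑_{a ∈ I} q_{aj} e_{k-2}(I \ {a})`
with `e_0 = 1`, `e_k(∅) = 0` for `k > 0` and `e_k = 0` for `k < 0`. The recursion holds for every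
`j ∉ I`, see `quantumElem_insert_one` and `quantumElem_insert`, so the choice is immaterial. -/
noncomputable def quantumElem (q : Sym2 ι → K) (I : Finset ι) (k : ℕ) : MvPolynomial ι K :=
  match k with
  | 0 => 1
  | 1 =>
    if h : I.Nonempty then
      quantumElem q (I.erase (I.max' h)) 1 + MvPolynomial.X (I.max' h)
    else 0
  | k + 2 =>
    if h : I.Nonempty then
      quantumElem q (I.erase (I.max' h)) (k + 2)
        + MvPolynomial.X (I.max' h) * quantumElem q (I.erase (I.max' h)) (k + 1)
        + ∑ a ∈ (I.erase (I.max' h)).attach, MvPolynomial.C (q s(a.1, I.max' h)) *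
            quantumElem q ((I.erase (I.max' h)).erase a.1) k
    else 0
termination_by I.card
decreasing_by
  · exact Finset.card_erase_lt_of_mem (I.max'_mem h)
  · exact Finset.card_erase_lt_of_mem (I.max'_mem h)
  · exact Finset.card_erase_lt_of_mem (I.max'_mem h)
  · exact (Finset.card_erase_lt_of_mem a.2).trans (Finset.card_erase_lt_of_mem (I.max'_mem h))

theorem quantumElem_zero (q : Sym2 ι → K) (I : Finset ι) : quantumElem q I 0 = 1 := by
  rw [quantumElem]

theorem quantumElem_empty (q : Sym2 ι → K) (k : ℕ) : quantumElem q ∅ (k + 1) = 0 := by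
  rcases k with _ | k <;> rw [quantumElem] <;> simp

theorem quantumElem_max_one (q : Sym2 ι → K) (I : Finset ι) (j : ι) (hj : ∀ a ∈ I, a < j) :
    quantumElem q (insert j I) 1 = quantumElem q I 1 + MvPolynomial.X j := by
  have hmax : (insert j I).max' (Finset.insert_nonempty j I) = j := by
    apply le_antisymm
    · apply Finset.max'_le
      intro a ha
      rcases Finset.mem_insert.1 ha with rfl | ha
      · exact le_rfl
      · exact (hj a ha).le
    · exact Finset.le_max' _ _ (Finset.mem_insert_self j I)
  have hj' : j ∉ I := fun h => lt_irrefl j (hj j h)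
  rw [quantumElem, dif_pos (Finset.insert_nonempty j I), hmax, Finset.erase_insert hj']

theorem quantumElem_max (q : Sym2 ι → K) (I : Finset ι) (j : ι) (hj : ∀ a ∈ I, a < j) (k : ℕ) :
    quantumElem q (insert j I) (k + 2) = quantumElem q I (k + 2)
      + MvPolynomial.X j * quantumElem q I (k + 1)
      + ∑ a ∈ I, MvPolynomial.C (q s(a, j)) * quantumElem q (I.erase a) k := by
  have hmax : (insert j I).max' (Finset.insert_nonempty j I) = j := by
    apply le_antisymm
    · apply Finset.max'_le
      intro a ha
      rcases Finset.mem_insert.1 ha with rfl | ha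
      · exact le_rfl
      · exact (hj a ha).le
    · exact Finset.le_max' _ _ (Finset.mem_insert_self j I)
  have hj' : j ∉ I := fun h => lt_irrefl j (hj j h)
  rw [quantumElem, dif_pos (Finset.insert_nonempty j I), hmax, Finset.erase_insert hj',
    Finset.sum_attach I (fun a => MvPolynomial.C (q s(a, j)) * quantumElem q (I.erase a) k)]

/-- The recursion for `k = 1` (where `e_0 = 1` and `e_{-1} = 0`), for every `j ∉ I`. -/
theorem quantumElem_insert_one (q : Sym2 ι → K) (I : Finset ι) (j : ι) (hj : j ∉ I) :
    quantumElem q (insert j I) 1 = quantumElem q I 1 + MvPolynomial.X j := by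
  have key : ∀ J : Finset ι, quantumElem q J 1 = ∑ a ∈ J, MvPolynomial.X a := by
    intro J
    induction J using Finset.induction_on_max with
    | empty => simpa using quantumElem_empty q 0
    | insert a s ha ih =>
      rw [quantumElem_max_one q s a ha, ih,
        Finset.sum_insert (fun h => lt_irrefl a (ha a h)), add_comm]
  rw [key, key, Finset.sum_insert hj, add_comm]

/-- The recursion for `k + 2`, for every `j ∉ I`. -/
theorem quantumElem_insert (q : Sym2 ι → K) (I : Finset ι) (j : ι) (hj : j ∉ I) (k : ℕ) :
    quantumElem q (insert j I) (k + 2) = quantumElem q I (k + 2)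
      + MvPolynomial.X j * quantumElem q I (k + 1)
      + ∑ a ∈ I, MvPolynomial.C (q s(a, j)) * quantumElem q (I.erase a) k := by
  induction hc : I.card using Nat.strong_induction_on generalizing I j k with
  | _ c ih =>
  subst hc
  by_cases hmax : ∀ a ∈ I, a < j
  · exact quantumElem_max q I j hmax k
  push Not at hmax
  have hne : I.Nonempty := by
    obtain ⟨a, ha, -⟩ := hmax
    exact ⟨a, ha⟩
  -- split off the largest element `M` of `I`, which is larger than `j`
  obtain ⟨M, L, hML, rfl, hjM, hjL, hL⟩ : ∃ M, ∃ L : Finset ι, M ∉ L ∧ insert M L = I ∧ j < M ∧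
      j ∉ L ∧ ∀ a ∈ L, a < M := by
    refine ⟨I.max' hne, I.erase (I.max' hne), Finset.notMem_erase _ _,
      Finset.insert_erase (I.max'_mem hne), ?_, fun h => hj (Finset.mem_of_mem_erase h), ?_⟩
    · obtain ⟨a, ha, haj⟩ := hmax
      refine lt_of_le_of_ne (haj.trans (I.le_max' a ha)) ?_
      rintro h
      exact hj (h ▸ I.max'_mem hne)
    · intro a ha
      exact lt_of_le_of_ne (I.le_max' a (Finset.mem_of_mem_erase ha)) (Finset.ne_of_mem_erase ha)
  have hcard : (insert M L).card = L.card + 1 := Finset.card_insert_of_notMem hML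
  have hjL' : ∀ a ∈ insert j L, a < M := by
    intro a ha
    rcases Finset.mem_insert.1 ha with rfl | ha
    · exact hjM
    · exact hL a ha
  have herase : ∀ a ∈ L, (insert M L).erase a = insert M (L.erase a) := fun a ha =>
    Finset.erase_insert_of_ne (fun h => hML (h ▸ ha))
  have herase' : ∀ a ∈ L, (insert j L).erase a = insert j (L.erase a) := fun a ha =>
    Finset.erase_insert_of_ne (fun h => hjL (h ▸ ha))
  have hA := ih L.card (by omega) L j hjL k rfl
  have hM2 := quantumElem_max q L M hL k
  have hM1 : ∀ k, quantumElem q (insert j L) (k + 1) =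
      quantumElem q L (k + 1) + MvPolynomial.X j * quantumElem q L k
        + (match k with
          | 0 => 0
          | k' + 1 => ∑ a ∈ L, MvPolynomial.C (q s(a, j)) * quantumElem q (L.erase a) k') := by
    intro k
    rcases k with _ | k
    · simp [quantumElem_insert_one q L j hjL, quantumElem_zero]
    · exact ih L.card (by omega) L j hjL k rfl
  have hM1' : ∀ k, quantumElem q (insert M L) (k + 1) =
      quantumElem q L (k + 1) + MvPolynomial.X M * quantumElem q L k
        + (match k with
          | 0 => 0
          | k' + 1 => ∑ a ∈ L, MvPolynomial.C (q s(a, M)) * quantumElem q (L.erase a) k') := by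
    intro k
    rcases k with _ | k
    · simp [quantumElem_insert_one q L M hML, quantumElem_zero]
    · exact quantumElem_max q L M hL k
  rw [Finset.insert_comm, quantumElem_max q (insert j L) M hjL' k, hM1 (k + 1), hM1 k,
    hM1' (k + 1), hM1' k, Finset.sum_insert hjL, Finset.sum_insert hML,
    Finset.erase_insert hjL, Finset.erase_insert hML, Sym2.eq_swap (a := M) (b := j)]
  -- the double sums over `L`
  have hD : ∑ a ∈ L, MvPolynomial.C (q s(a, M)) * quantumElem q ((insert j L).erase a) k
        - ∑ a ∈ L, MvPolynomial.C (q s(a, M)) * quantumElem q (L.erase a) k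
      - MvPolynomial.X j * (match k with
          | 0 => 0
          | k' + 1 => ∑ a ∈ L, MvPolynomial.C (q s(a, M)) * quantumElem q (L.erase a) k')
      = ∑ a ∈ L, MvPolynomial.C (q s(a, j)) * quantumElem q ((insert M L).erase a) k
        - ∑ a ∈ L, MvPolynomial.C (q s(a, j)) * quantumElem q (L.erase a) k
      - MvPolynomial.X M * (match k with
          | 0 => 0
          | k' + 1 => ∑ a ∈ L, MvPolynomial.C (q s(a, j)) * quantumElem q (L.erase a) k') := by
    rcases k with _ | _ | k
    · simp [quantumElem_zero]
    · simp only [Finset.mul_sum, ← Finset.sum_sub_distrib, quantumElem_zero]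
      have h1 : ∀ a ∈ L, MvPolynomial.C (q s(a, M)) * quantumElem q ((insert j L).erase a) 1
          - MvPolynomial.C (q s(a, M)) * quantumElem q (L.erase a) 1
          - MvPolynomial.X j * (MvPolynomial.C (q s(a, M)) * 1) = 0 := by
        intro a ha
        rw [herase' a ha, quantumElem_insert_one q _ j fun h => hjL (Finset.mem_of_mem_erase h)]
        ring
      have h2 : ∀ a ∈ L, MvPolynomial.C (q s(a, j)) * quantumElem q ((insert M L).erase a) 1
          - MvPolynomial.C (q s(a, j)) * quantumElem q (L.erase a) 1
          - MvPolynomial.X M * (MvPolynomial.C (q s(a, j)) * 1) = 0 := by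
        intro a ha
        rw [herase a ha, quantumElem_insert_one q _ M fun h => hML (Finset.mem_of_mem_erase h)]
        ring
      exact (Finset.sum_eq_zero h1).trans (Finset.sum_eq_zero h2).symm
    · simp only [Finset.mul_sum, ← Finset.sum_sub_distrib]
      have h1 : ∀ a ∈ L, MvPolynomial.C (q s(a, M)) * quantumElem q ((insert j L).erase a) (k + 2)
          - MvPolynomial.C (q s(a, M)) * quantumElem q (L.erase a) (k + 2)
          - MvPolynomial.X j * (MvPolynomial.C (q s(a, M)) * quantumElem q (L.erase a) (k + 1))
          = ∑ b ∈ L.erase a, MvPolynomial.C (q s(a, M)) * (MvPolynomial.C (q s(b, j)) *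
              quantumElem q ((L.erase a).erase b) k) := by
        intro a ha
        rw [herase' a ha, ih (L.erase a).card (by
            have := Finset.card_erase_lt_of_mem ha
            omega) _ j (fun h => hjL (Finset.mem_of_mem_erase h)) k rfl, ← Finset.mul_sum]
        ring
      have h2 : ∀ a ∈ L, MvPolynomial.C (q s(a, j)) * quantumElem q ((insert M L).erase a) (k + 2)
          - MvPolynomial.C (q s(a, j)) * quantumElem q (L.erase a) (k + 2)
          - MvPolynomial.X M * (MvPolynomial.C (q s(a, j)) * quantumElem q (L.erase a) (k + 1))
          = ∑ b ∈ L.erase a, MvPolynomial.C (q s(a, j)) * (MvPolynomial.C (q s(b, M)) *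
              quantumElem q ((L.erase a).erase b) k) := by
        intro a ha
        rw [herase a ha, ih (L.erase a).card (by
            have := Finset.card_erase_lt_of_mem ha
            omega) _ M (fun h => hML (Finset.mem_of_mem_erase h)) k rfl, ← Finset.mul_sum]
        ring
      rw [Finset.sum_congr rfl h1, Finset.sum_congr rfl h2, Finset.sum_comm' (s' := fun b => L.erase b)
        (t' := L) (by
          intro a b
          simp only [Finset.mem_erase]
          tauto)]
      refine Finset.sum_congr rfl fun b _ => Finset.sum_congr rfl fun a _ => ?_
      rw [Finset.erase_right_comm]
      ring
  linear_combination hD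

end Polynomials

section Algebra

/-- Generators: the symbols `[i,j]` for `i ≠ j`, the variables `x_i`, and `t`. -/
inductive Gen (n : ℕ) : Type
  | br (i j : Fin n) (h : i ≠ j) : Gen n
  | x (i : Fin n) : Gen n
  | t : Gen n

variable {K : Type*} [CommRing K] {n : ℕ}

open Gen in
/-- The defining relations; `FreeAlgebra.ι K g` is the generator `g`. -/
inductive Rel (q : Sym2 (Fin n) → K) :
    FreeAlgebra K (Gen n) → FreeAlgebra K (Gen n) → Prop
  /-- `[i,j] = -[j,i]` -/
  | antisymm (i j : Fin n) (h : i ≠ j) :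
      Rel q (FreeAlgebra.ι K (br i j h)) (-FreeAlgebra.ι K (br j i h.symm))
  /-- `[i,j]² = q_{ij}` -/
  | sq (i j : Fin n) (h : i ≠ j) :
      Rel q (FreeAlgebra.ι K (br i j h) ^ 2) (algebraMap K _ (q s(i, j)))
  /-- `[i,j][k,l] = [k,l][i,j]` if `{i,j} ∩ {k,l} = ∅` -/
  | comm (i j k l : Fin n) (hij : i ≠ j) (hkl : k ≠ l)
      (hik : i ≠ k) (hil : i ≠ l) (hjk : j ≠ k) (hjl : j ≠ l) :
      Rel q (FreeAlgebra.ι K (br i j hij) * FreeAlgebra.ι K (br k l hkl))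
        (FreeAlgebra.ι K (br k l hkl) * FreeAlgebra.ι K (br i j hij))
  /-- `[i,j][j,k] + [j,k][k,i] + [k,i][i,j] = 0` -/
  | cyclic (i j k : Fin n) (hij : i ≠ j) (hjk : j ≠ k) (hki : k ≠ i) :
      Rel q (FreeAlgebra.ι K (br i j hij) * FreeAlgebra.ι K (br j k hjk)
        + FreeAlgebra.ι K (br j k hjk) * FreeAlgebra.ι K (br k i hki)
        + FreeAlgebra.ι K (br k i hki) * FreeAlgebra.ι K (br i j hij)) 0
  /-- `[i,j] x_k = x_k [i,j]` for `k ≠ i, j` -/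
  | br_x (i j k : Fin n) (hij : i ≠ j) (hki : k ≠ i) (hkj : k ≠ j) :
      Rel q (FreeAlgebra.ι K (br i j hij) * FreeAlgebra.ι K (x k))
        (FreeAlgebra.ι K (x k) * FreeAlgebra.ι K (br i j hij))
  /-- `[i,j] x_i = x_j [i,j] + t` for `i < j` -/
  | br_x_left (i j : Fin n) (h : i < j) :
      Rel q (FreeAlgebra.ι K (br i j h.ne) * FreeAlgebra.ι K (x i))
        (FreeAlgebra.ι K (x j) * FreeAlgebra.ι K (br i j h.ne) + FreeAlgebra.ι K t)
  /-- `[i,j] x_j = x_i [i,j] - t` for `i < j` -/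
  | br_x_right (i j : Fin n) (h : i < j) :
      Rel q (FreeAlgebra.ι K (br i j h.ne) * FreeAlgebra.ι K (x j))
        (FreeAlgebra.ι K (x i) * FreeAlgebra.ι K (br i j h.ne) - FreeAlgebra.ι K t)
  /-- `[i,j] t = t [i,j]` -/
  | br_t (i j : Fin n) (h : i ≠ j) :
      Rel q (FreeAlgebra.ι K (br i j h) * FreeAlgebra.ι K t)
        (FreeAlgebra.ι K t * FreeAlgebra.ι K (br i j h))
  /-- the `x_i` commute with each other -/
  | x_x (i j : Fin n) :
      Rel q (FreeAlgebra.ι K (x i) * FreeAlgebra.ι K (x j))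
        (FreeAlgebra.ι K (x j) * FreeAlgebra.ι K (x i))
  /-- `t` commutes with the `x_i` -/
  | x_t (i : Fin n) :
      Rel q (FreeAlgebra.ι K (x i) * FreeAlgebra.ι K t)
        (FreeAlgebra.ι K t * FreeAlgebra.ι K (x i))

/-- The extended quadratic algebra over `K` with parameters `q_{ij} = q_{ji} ∈ K`. -/
def ExtAlg (q : Sym2 (Fin n) → K) : Type _ := RingQuot (Rel q)

noncomputable instance (q : Sym2 (Fin n) → K) : Ring (ExtAlg q) :=
  inferInstanceAs (Ring (RingQuot (Rel q)))

noncomputable instance (q : Sym2 (Fin n) → K) : Algebra K (ExtAlg q) :=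
  inferInstanceAs (Algebra K (RingQuot (Rel q)))

variable (q : Sym2 (Fin n) → K)

/-- The quotient map from the free algebra. -/
noncomputable def mk : FreeAlgebra K (Gen n) →ₐ[K] ExtAlg q := RingQuot.mkAlgHom K (Rel q)

theorem mk_rel {a b : FreeAlgebra K (Gen n)} (h : Rel q a b) : mk q a = mk q b :=
  RingQuot.mkAlgHom_rel K h

/-- The image of a generator. -/
noncomputable def gen (g : Gen n) : ExtAlg q := mk q (FreeAlgebra.ι K g)

/-- The element `[i,j]` for `i ≠ j`; by convention `[i,i] = 0`. -/
noncomputable def br (i j : Fin n) : ExtAlg q := if h : i ≠ j then gen q (Gen.br i j h) else 0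

/-- The element `x_i`. -/
noncomputable def x (i : Fin n) : ExtAlg q := gen q (Gen.x i)

/-- The element `t`. -/
noncomputable def t : ExtAlg q := gen q Gen.t

/-- The Dunkl element `θ_i = x_i + ∑_{j ≠ i} [i,j]`. -/
noncomputable def dunkl (i : Fin n) : ExtAlg q :=
  x q i + ∑ j ∈ Finset.univ.filter (fun j => j ≠ i), br q i j

theorem x_commute (i j : Fin n) : Commute (x q i) (x q j) := by
  have h := mk_rel q (Rel.x_x i j)
  rw [map_mul, map_mul] at h
  exact h

theorem br_antisymm (i j : Fin n) : br q i j = -br q j i := by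
  by_cases h : i = j
  · simp [br, h]
  · have h1 := mk_rel q (Rel.antisymm i j h)
    rw [map_neg] at h1
    rw [br, br, dif_pos h, dif_pos (Ne.symm h)]
    exact h1

theorem br_x_commute (i j k : Fin n) (hki : k ≠ i) (hkj : k ≠ j) :
    Commute (br q i j) (x q k) := by
  by_cases h : i = j
  · simp [br, h]
  · have h1 := mk_rel q (Rel.br_x i j k h hki hkj)
    rw [map_mul, map_mul] at h1
    rw [br, dif_pos h]
    exact h1

theorem br_br_commute (i j k l : Fin n) (hik : i ≠ k) (hil : i ≠ l) (hjk : j ≠ k) (hjl : j ≠ l) :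
    Commute (br q i j) (br q k l) := by
  by_cases h : i = j
  · simp [br, h]
  by_cases h' : k = l
  · simp [br, h']
  have h1 := mk_rel q (Rel.comm i j k l h h' hik hil hjk hjl)
  rw [map_mul, map_mul] at h1
  rw [br, br, dif_pos h, dif_pos h']
  exact h1

theorem br_cyclic (i j k : Fin n) (hij : i ≠ j) (hjk : j ≠ k) (hki : k ≠ i) :
    br q i j * br q j k + br q j k * br q k i + br q k i * br q i j = 0 := by
  have h1 := mk_rel q (Rel.cyclic i j k hij hjk hki)
  rw [map_add, map_add, map_mul, map_mul, map_mul, map_zero] at h1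
  rw [br, br, br, dif_pos hij, dif_pos hjk, dif_pos hki]
  exact h1

theorem br_x_add_commute_of_lt (i j : Fin n) (h : i < j) :
    Commute (br q i j) (x q i + x q j) := by
  have h1 := mk_rel q (Rel.br_x_left i j h)
  have h2 := mk_rel q (Rel.br_x_right i j h)
  rw [map_add, map_mul, map_mul] at h1
  rw [map_sub, map_mul, map_mul] at h2
  have e : br q i j = gen q (Gen.br i j h.ne) := by rw [br, dif_pos h.ne]
  change _ * _ = _ * _
  rw [e, x, x, gen, gen, gen, mul_add, h1, h2, add_mul]
  abel

theorem br_x_add_commute (i j : Fin n) : Commute (br q i j) (x q i + x q j) := by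
  rcases lt_trichotomy i j with h | h | h
  · exact br_x_add_commute_of_lt q i j h
  · simp [br, h]
  · rw [br_antisymm, add_comm]
    exact (br_x_add_commute_of_lt q j i h).neg_left

/-- The Dunkl elements commute with each other. -/
theorem dunkl_commute (i j : Fin n) : Commute (dunkl q i) (dunkl q j) := by
  by_cases hij : i = j
  · rw [hij]
  set T : Finset (Fin n) := Finset.univ.filter fun k => k ≠ i ∧ k ≠ j with hT
  have hTi : ∀ k ∈ T, k ≠ i := fun k hk => (Finset.mem_filter.1 hk).2.1
  have hTj : ∀ k ∈ T, k ≠ j := fun k hk => (Finset.mem_filter.1 hk).2.2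
  have ei : Finset.univ.filter (fun k => k ≠ i) = insert j T := by
    ext k
    simp only [hT, Finset.mem_filter, Finset.mem_univ, true_and, Finset.mem_insert]
    by_cases h : k = j
    · simp [h, Ne.symm hij]
    · simp [h]
  have ej : Finset.univ.filter (fun k => k ≠ j) = insert i T := by
    ext k
    simp only [hT, Finset.mem_filter, Finset.mem_univ, true_and, Finset.mem_insert]
    by_cases h : k = i
    · simp [h, hij]
    · simp [h]
  have hi : dunkl q i = x q i + br q i j + ∑ k ∈ T, br q i k := by
    rw [dunkl, ei, Finset.sum_insert (fun h => hTj j h rfl), add_assoc]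
  have hj : dunkl q j = x q j - br q i j + ∑ k ∈ T, br q j k := by
    rw [dunkl, ej, Finset.sum_insert (fun h => hTi i h rfl), br_antisymm q j i]
    abel
  have c1 : Commute (x q i) (∑ k ∈ T, br q j k) :=
    Commute.sum_right _ _ _ fun k hk => (br_x_commute q j k i hij (hTi k hk).symm).symm
  have c2 : Commute (∑ k ∈ T, br q i k) (x q j) :=
    Commute.sum_left _ _ _ fun k hk => br_x_commute q i k j (Ne.symm hij) (hTj k hk).symm
  have c3 := x_commute q i j
  have c4 := br_x_add_commute q i j
  have hPQ : (∑ k ∈ T, br q i k) * (∑ k ∈ T, br q j k)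
      - (∑ k ∈ T, br q j k) * (∑ k ∈ T, br q i k)
      = ∑ k ∈ T, (br q i k * br q j k - br q j k * br q i k) := by
    rw [Finset.sum_mul_sum, Finset.sum_mul_sum, Finset.sum_comm (s := T) (t := T)
      (f := fun a b => br q j a * br q i b), ← Finset.sum_sub_distrib]
    refine Finset.sum_congr rfl fun k hk => ?_
    rw [← Finset.sum_sub_distrib]
    refine Finset.sum_eq_single_of_mem k hk fun l hl hlk => ?_
    rw [sub_eq_zero]
    exact br_br_commute q i k j l hij (hTi l hl).symm (hTj k hk) (Ne.symm hlk)
  have hc : ∀ k ∈ T, (br q i j * br q j k - br q j k * br q i j)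
      + (br q i j * br q i k - br q i k * br q i j)
      + (br q i k * br q j k - br q j k * br q i k) = 0 := by
    intro k hk
    have h1 := br_cyclic q i j k hij (hTj k hk).symm (hTi k hk)
    have h2 := br_cyclic q j i k (Ne.symm hij) (hTi k hk).symm (hTj k hk)
    rw [br_antisymm q k i] at h1
    rw [br_antisymm q k j, br_antisymm q j i] at h2
    have h3 := sub_eq_zero.2 (h1.trans h2.symm)
    rw [← h3]
    simp only [mul_neg, neg_mul, neg_neg]
    abel
  have hS := Finset.sum_eq_zero hc
  rw [Finset.sum_add_distrib, ← hPQ, Finset.sum_add_distrib, Finset.sum_sub_distrib,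
    Finset.sum_sub_distrib, ← Finset.mul_sum, ← Finset.mul_sum, ← Finset.sum_mul,
    ← Finset.sum_mul] at hS
  rw [hi, hj]
  generalize (∑ k ∈ T, br q i k) = P at *
  generalize (∑ k ∈ T, br q j k) = Q at *
  have d1 := sub_eq_zero.2 c1.eq
  have d2 := sub_eq_zero.2 c2.eq
  have d3 := sub_eq_zero.2 c3.eq
  have d4 := sub_eq_zero.2 c4.eq
  rw [commute_iff_eq, ← sub_eq_zero]
  have : (x q i + br q i j + P) * (x q j - br q i j + Q)
      - (x q j - br q i j + Q) * (x q i + br q i j + P)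
      = (x q i * x q j - x q j * x q i) + (x q i * Q - Q * x q i) + (P * x q j - x q j * P)
        + (br q i j * (x q i + x q j) - (x q i + x q j) * br q i j)
        + (br q i j * Q - Q * br q i j + (br q i j * P - P * br q i j) + (P * Q - Q * P)) := by
    simp only [mul_add, add_mul, mul_sub, sub_mul]
    abel
  rw [this, d1, d2, d3, d4, hS]
  simp

/-- Evaluation of polynomials at the (commuting) Dunkl elements: the algebra homomorphism with
`X_i ↦ θ_i`, see `dunklEval_X`. -/
noncomputable def dunklEval : MvPolynomial (Fin n) K →ₐ[K] ExtAlg q :=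
  letI : CommRing (Algebra.adjoin K (Set.range (dunkl q))) :=
    { (inferInstance : Ring (Algebra.adjoin K (Set.range (dunkl q)))) with
      mul_comm := (Algebra.isMulCommutative_adjoin K (by
        rintro _ ⟨i, rfl⟩ _ ⟨j, rfl⟩
        exact dunkl_commute q i j)).is_comm.comm }
  (Algebra.adjoin K (Set.range (dunkl q))).val.comp
    (MvPolynomial.aeval fun i =>
      (⟨dunkl q i, Algebra.subset_adjoin ⟨i, rfl⟩⟩ : Algebra.adjoin K (Set.range (dunkl q))))

theorem dunklEval_X (i : Fin n) : dunklEval q (MvPolynomial.X i) = dunkl q i := by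
  simp [dunklEval]

/-- `X_S = ∏_{s ∈ S} x_s`. -/
noncomputable def xProd (S : Finset (Fin n)) : ExtAlg q :=
  S.noncommProd (x q) fun i _ j _ _ => x_commute q i j

end Algebra

/-- The coefficient ring `ℤ[q_{ij} = q_{ji} | i ≠ j]`. -/
abbrev Coeff (n : ℕ) : Type := MvPolynomial {e : Sym2 (Fin n) // ¬ e.IsDiag} ℤ

/-- The indeterminates `q_{ij}`, `i ≠ j` (with the irrelevant convention `q_{ii} = 0`). -/
noncomputable def qVar (n : ℕ) (e : Sym2 (Fin n)) : Coeff n :=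
  open Classical in if h : e.IsDiag then 0 else MvPolynomial.X ⟨e, h⟩

/-- The indices `1, …, m` in `{1, …, n}`; with the indices counted from `0`, those below `m`. -/
def initial (n m : ℕ) : Finset (Fin n) := Finset.univ.filter fun i => i.val < m

/-- `N(a, 2b) = (2b-1)!! * binom(a+2b, 2b)`, as a function of `a` and `b`, with `(-1)!! = 1`. -/
def pieriN (a b : ℕ) : ℕ := Nat.doubleFactorial (2 * b - 1) * (a + 2 * b).choose (2 * b)

/-- The pairs of sequences `(i_1, …, i_l)`, `(j_1, …, j_l)` with the `i_a` distinct elements of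
`{1, …, m} \ S`, with `m < j_a ≤ n`, and with `j_1 ≤ ⋯ ≤ j_l`. -/
def pieriPairs (n m : ℕ) (S : Finset (Fin n)) (l : ℕ) :
    Finset ((Fin l → Fin n) × (Fin l → Fin n)) :=
  open Classical in
  Finset.univ.filter fun p =>
    Function.Injective p.1 ∧ (∀ a, p.1 a ∈ initial n m \ S) ∧
      (∀ a, p.2 a ∉ initial n m) ∧ Monotone p.2

end QuantumPieri

/-! For a set `I` of indices and a list `L` of further indices, let F(L; I) be `bracketSum`: the sum
of all products Y(B)[i_1,j_1]⋯[i_l,j_l] in which the i's enumerate I \ B and the j's lie in `L`.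
Here Y(B) sums, over the partial matchings of B, the x's of the unmatched points times one factor -t
per pair. When `L` enumerates the complement of `I`, this is the case k = m of the right-hand side.

It is enough to treat that case, because the relations survive the substitution x_a ↦ x_a + X with X
a central indeterminate (`ExtRelations.shift`). Points that contribute X instead of x_a make Y(B) a
sum of X_S times Hermite-type polynomials in X and t, whose coefficients are the numbers N(a, 2r)
with signs and powers of t. The coefficient of X^(m-k) is then the right-hand side for k, so a
single polynomial P(I), `pieriPoly`, encodes all k at once.

It remains to see that P(I) obeys the generating-function form of the recursion for quantum
elementary polynomials: P(I ∪ {v}) = P(I)(θ_v + X) + ∑_{a ∈ I} q_{av} P(I \ {a}). This is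
`bracketSum_insert`, which moves v from the list into the set. Two facts carry it. Multiplying F(L;
I) by the part of θ_v that does not involve indices outside L and I gives F(L; I ∪ {v}) with
explicit corrections (`bracketSum_mul_partialDunkl`); this rests on the three-term relation and on
the cancellation of the t's from [v,a]x_v against the matched pairs. The quadratic terms are
governed by the conjugation identity `sum_br_mul_bracketSum_mul_br`, the only source of the q's. -/

namespace QuantumPieri

/-! ### Bracket sums over an abstract ring with the relations: commutation and reordering. -/

section Abstract

variable {ι R : Type*} [Ring R]

/-- The relations of the extended quadratic algebra, for elements of an arbitrary ring. -/
structure ExtRelations (br : ι → ι → R) (x : ι → R) (t : R) (q : ι → ι → R) : Prop where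
  antisymm : ∀ a b, br a b = -br b a
  sq : ∀ a b, a ≠ b → br a b * br a b = q a b
  comm : ∀ a b c d, a ≠ c → a ≠ d → b ≠ c → b ≠ d → Commute (br a b) (br c d)
  cyclic : ∀ a b c, a ≠ b → b ≠ c → c ≠ a →
    br a b * br b c + br b c * br c a + br c a * br a b = 0
  br_x : ∀ a b c, c ≠ a → c ≠ b → Commute (br a b) (x c)
  br_x_left : ∀ a b, a ≠ b → br a b * x a = x b * br a b + t
  t_br : ∀ a b, Commute t (br a b)
  t_x : ∀ a, Commute t (x a)
  x_x : ∀ a b, Commute (x a) (x b)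
  q_central : ∀ a b y, Commute (q a b) y

namespace ExtRelations

variable {br : ι → ι → R} {x : ι → R} {t : R} {q : ι → ι → R}

/-- The three-term relation as a rule for exchanging `[a,v]` and `[b,v]`. -/
theorem br_mul_br (h : ExtRelations br x t q) {a b v : ι} (hab : a ≠ b) (hav : a ≠ v)
    (hbv : b ≠ v) : br a v * br b v = br b a * br a v - br b v * br b a := by
  have h1 := h.cyclic b a v hab.symm hav hbv.symm
  rw [h.antisymm v b] at h1
  rw [eq_comm, ← sub_eq_zero, ← h1]
  noncomm_ring

end ExtRelations

variable [DecidableEq ι]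

theorem sum_sum_erase_comm {M : Type*} [AddCommMonoid M] (C : Finset ι) (f : ι → ι → M) :
    ∑ a ∈ C, ∑ b ∈ C.erase a, f a b = ∑ b ∈ C, ∑ a ∈ C.erase b, f a b :=
  Finset.sum_comm' fun a b => by
    simp only [Finset.mem_erase]
    tauto

theorem sum_powersetCard_sum_erase {M : Type*} [AddCommMonoid M] (U : Finset ι) (l : ℕ)
    (f : ι → Finset ι → M) :
    ∑ C ∈ U.powersetCard (l + 1), ∑ a ∈ C, f a (C.erase a) =
      ∑ a ∈ U, ∑ C ∈ (U.erase a).powersetCard l, f a C := by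
  rw [Finset.sum_sigma', Finset.sum_sigma']
  refine Finset.sum_bij' (fun s _ => ⟨s.2, s.1.erase s.2⟩) (fun s _ => ⟨insert s.1 s.2, s.1⟩)
    ?_ ?_ ?_ ?_ ?_
  · rintro ⟨C, a⟩ h
    simp only [Finset.mem_sigma, Finset.mem_powersetCard] at h ⊢
    refine ⟨h.1.1 h.2, Finset.erase_subset_erase a h.1.1, ?_⟩
    rw [Finset.card_erase_of_mem h.2, h.1.2, Nat.add_sub_cancel]
  · rintro ⟨a, C⟩ h
    simp only [Finset.mem_sigma, Finset.mem_powersetCard, Finset.subset_erase] at h ⊢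
    refine ⟨⟨Finset.insert_subset h.1 h.2.1.1, ?_⟩, Finset.mem_insert_self a C⟩
    rw [Finset.card_insert_of_notMem h.2.1.2, h.2.2]
  · rintro ⟨C, a⟩ h
    simp only [Finset.mem_sigma] at h
    simp only [Finset.insert_erase h.2]
  · rintro ⟨a, C⟩ h
    simp only [Finset.mem_sigma, Finset.mem_powersetCard, Finset.subset_erase] at h
    simp only [Finset.erase_insert h.2.1.2]
  · intros
    rfl

/-- The sum of the products `Y(B) [i_1, j_1] ⋯ [i_l, j_l]` over all subsets `B` of `C`, all
enumerations `i_1, …, i_l` of `C \ B` and all sequences `j_1, …, j_l` of members of `L` whose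
positions in `L` weakly decrease; computed by splitting off the last factor. -/
noncomputable def bracketSum (br : ι → ι → R) (Y : Finset ι → R) : List ι → Finset ι → R
  | [], C => Y C
  | j :: L, C => bracketSum br Y L C
      + ∑ c ∈ C.attach, bracketSum br Y (j :: L) (C.erase c.1) * br c.1 j
termination_by L C => (L.length, C.card)
decreasing_by
  · exact Prod.Lex.left _ _ (by simp)
  · exact Prod.Lex.right _ (Finset.card_erase_lt_of_mem c.2)

theorem bracketSum_nil (br : ι → ι → R) (Y : Finset ι → R) (C : Finset ι) :
    bracketSum br Y [] C = Y C := by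
  rw [bracketSum]

theorem bracketSum_cons (br : ι → ι → R) (Y : Finset ι → R) (j : ι) (L : List ι) (C : Finset ι) :
    bracketSum br Y (j :: L) C = bracketSum br Y L C
      + ∑ c ∈ C, bracketSum br Y (j :: L) (C.erase c) * br c j := by
  rw [bracketSum, Finset.sum_attach C fun c => bracketSum br Y (j :: L) (C.erase c) * br c j]

/-- The recursion for the sum of all products of `x`'s and of factors `-t` over the partial
matchings of a finite set. -/
def IsMatchingSum (x : ι → R) (t : R) (Y : Finset ι → R) : Prop :=
  Y ∅ = 1 ∧ ∀ B v, v ∉ B → Y (insert v B) = x v * Y B - t * ∑ a ∈ B, Y (B.erase a)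

variable {br : ι → ι → R} {x : ι → R} {t : R} {q : ι → ι → R} {Y : Finset ι → R}

theorem IsMatchingSum.commute (hY : IsMatchingSum x t Y) {y : R} (ht : Commute y t)
    (C : Finset ι) (hx : ∀ c ∈ C, Commute y (x c)) : Commute y (Y C) := by
  induction C using Finset.strongInduction with
  | _ C ih =>
  rcases C.eq_empty_or_nonempty with rfl | ⟨v, hv⟩
  · rw [hY.1]
    exact Commute.one_right y
  · have key := hY.2 (C.erase v) v (Finset.notMem_erase v C)
    rw [Finset.insert_erase hv] at key
    have hs : ∀ s, s ⊂ C → Commute y (Y s) := fun s hs =>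
      ih s hs fun c hc => hx c (hs.1 hc)
    rw [key]
    refine ((hx v hv).mul_right (hs _ (Finset.erase_ssubset hv))).sub_right
      (ht.mul_right (Commute.sum_right _ _ _ fun a ha => hs _ ?_))
    exact (Finset.erase_ssubset ha).trans (Finset.erase_ssubset hv)

theorem bracketSum_commute (hY : IsMatchingSum x t Y) {y : R} (ht : Commute y t) (L : List ι)
    (C : Finset ι) (hx : ∀ c ∈ C, Commute y (x c))
    (hbr : ∀ c ∈ C, ∀ j ∈ L, Commute y (br c j)) : Commute y (bracketSum br Y L C) := by
  induction L generalizing C with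
  | nil => rw [bracketSum_nil]; exact hY.commute ht C hx
  | cons j L ihL =>
    induction C using Finset.strongInduction with
    | _ C ih =>
    rw [bracketSum_cons]
    refine (ihL C hx fun c hc i hi => hbr c hc i (List.mem_cons_of_mem j hi)).add_right
      (Commute.sum_right _ _ _ fun c hc => (ih _ (Finset.erase_ssubset hc) ?_ ?_).mul_right
        (hbr c hc j List.mem_cons_self))
    · exact fun d hd => hx d (Finset.mem_of_mem_erase hd)
    · exact fun d hd => hbr d (Finset.mem_of_mem_erase hd)

/-- `[a,b]` commutes with a bracket sum that involves neither `a` nor `b`. -/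
theorem ExtRelations.commute_bracketSum (h : ExtRelations br x t q) (hY : IsMatchingSum x t Y)
    (a b : ι) (L : List ι) (C : Finset ι) (haC : a ∉ C) (hbC : b ∉ C) (haL : a ∉ L)
    (hbL : b ∉ L) : Commute (br a b) (bracketSum br Y L C) :=
  bracketSum_commute hY (h.t_br a b).symm L C
    (fun c hc => h.br_x a b c (fun e => haC (e ▸ hc)) fun e => hbC (e ▸ hc))
    fun c hc j hj => h.comm a b c j (fun e => haC (e ▸ hc)) (fun e => haL (e ▸ hj))
      (fun e => hbC (e ▸ hc)) fun e => hbL (e ▸ hj)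

/-- The recursion that splits off a first factor. -/
theorem bracketSum_cons_left (h : ExtRelations br x t q) (hY : IsMatchingSum x t Y) (j : ι)
    (L : List ι) (hj : j ∉ L) (C : Finset ι) (hjC : j ∉ C) (hLC : ∀ c ∈ C, c ∉ L) :
    bracketSum br Y (j :: L) C = bracketSum br Y L C
      + ∑ c ∈ C, br c j * bracketSum br Y (j :: L) (C.erase c) := by
  induction C using Finset.strongInduction with
  | _ C ih =>
  -- Taking one factor off each end leaves double sums that differ only by exchanging c and d, so
  -- splitting off a first factor and splitting off a last factor give the same total.
  have hc : ∀ c ∈ C, br c j * bracketSum br Y (j :: L) (C.erase c)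
      = bracketSum br Y L (C.erase c) * br c j
        + ∑ d ∈ C.erase c, br c j * bracketSum br Y (j :: L) ((C.erase c).erase d) * br d j := by
    intro c hc
    rw [bracketSum_cons, mul_add, Finset.mul_sum, (h.commute_bracketSum hY c j L (C.erase c)
      (Finset.notMem_erase c C) (fun h => hjC (Finset.mem_of_mem_erase h)) (hLC c hc) hj).eq]
    simp only [mul_assoc]
  have hc' : ∀ c ∈ C, bracketSum br Y (j :: L) (C.erase c) * br c j
      = bracketSum br Y L (C.erase c) * br c j
        + ∑ d ∈ C.erase c, br d j * bracketSum br Y (j :: L) ((C.erase c).erase d) * br c j := by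
    intro c hc
    rw [ih _ (Finset.erase_ssubset hc) (fun h => hjC (Finset.mem_of_mem_erase h))
      fun d hd => hLC d (Finset.mem_of_mem_erase hd), add_mul, Finset.sum_mul]
  rw [bracketSum_cons, Finset.sum_congr rfl hc, Finset.sum_congr rfl hc', Finset.sum_add_distrib,
    Finset.sum_add_distrib, sum_sum_erase_comm]
  simp only [Finset.erase_right_comm]

/-- Peeling off both heads by inclusion–exclusion leaves single sums symmetric in i and j, and a
double sum over products [d,i][c,j] with c ≠ d. These two factors commute, so exchanging c and d
shows that the double sum is symmetric too. -/
theorem bracketSum_swap (h : ExtRelations br x t q) (i j : ι) (hij : i ≠ j)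
    (L : List ι) (C : Finset ι) (hiC : i ∉ C) (hjC : j ∉ C) :
    bracketSum br Y (i :: j :: L) C = bracketSum br Y (j :: i :: L) C := by
  induction C using Finset.strongInduction with
  | _ C ih =>
  have key : ∀ i j, i ≠ j → i ∉ C → j ∉ C → (∀ s, s ⊂ C → bracketSum br Y (i :: j :: L) s =
      bracketSum br Y (j :: i :: L) s) → bracketSum br Y (i :: j :: L) C = bracketSum br Y L C
        + ∑ c ∈ C, bracketSum br Y (i :: j :: L) (C.erase c) * (br c j + br c i)
        - ∑ c ∈ C, ∑ d ∈ C.erase c,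
          bracketSum br Y (i :: j :: L) ((C.erase c).erase d) * (br d i * br c j) := by
    intro i j hij hiC hjC hs
    have hc : ∀ c ∈ C, bracketSum br Y (j :: L) (C.erase c) * br c j
        = bracketSum br Y (i :: j :: L) (C.erase c) * br c j
          - ∑ d ∈ C.erase c,
            bracketSum br Y (i :: j :: L) ((C.erase c).erase d) * (br d i * br c j) := by
      intro c hc
      rw [eq_sub_iff_add_eq]
      conv_rhs => rw [bracketSum_cons, add_mul, Finset.sum_mul]
      simp only [mul_assoc]
    rw [bracketSum_cons, bracketSum_cons br Y j L C, Finset.sum_congr rfl hc]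
    simp only [mul_add, Finset.sum_add_distrib, Finset.sum_sub_distrib]
    abel
  have hs : ∀ s, s ⊂ C → bracketSum br Y (i :: j :: L) s = bracketSum br Y (j :: i :: L) s :=
    fun s hs => ih s hs (fun h => hiC (hs.1 h)) fun h => hjC (hs.1 h)
  rw [key i j hij hiC hjC hs, key j i hij.symm hjC hiC fun s h => (hs s h).symm, sum_sum_erase_comm]
  congr 1
  · congr 1
    refine Finset.sum_congr rfl fun c hc => ?_
    rw [hs _ (Finset.erase_ssubset hc), add_comm]
  · refine Finset.sum_congr rfl fun c hc => Finset.sum_congr rfl fun d hd => ?_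
    rw [Finset.erase_right_comm,
      hs _ ((Finset.erase_ssubset hd).trans (Finset.erase_ssubset hc))]
    congr 1
    exact h.comm c i d j (Finset.ne_of_mem_erase hd).symm (fun e => hjC (e ▸ hc))
      (fun e => hiC (e ▸ Finset.mem_of_mem_erase hd)) hij

/-- The order of the list is only bookkeeping: this allows the complement of `I` to be enumerated
with any chosen index first. -/
theorem bracketSum_perm (h : ExtRelations br x t q) {L L' : List ι} (hL : L.Perm L')
    (hnd : L.Nodup) (C : Finset ι) (hLC : ∀ c ∈ C, c ∉ L) :
    bracketSum br Y L C = bracketSum br Y L' C := by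
  induction hL generalizing C with
  | nil => rfl
  | cons j hp ih =>
    induction C using Finset.strongInduction with
    | _ C ihC =>
    rw [bracketSum_cons, bracketSum_cons, ih (List.nodup_cons.1 hnd).2 C fun c hc h =>
      hLC c hc (List.mem_cons_of_mem j h)]
    congr 1
    refine Finset.sum_congr rfl fun c hc => ?_
    rw [ihC _ (Finset.erase_ssubset hc) fun d hd => hLC d (Finset.mem_of_mem_erase hd)]
  | swap i j L =>
    refine bracketSum_swap h j i ?_ L C (fun e => hLC _ e (by simp)) fun e => hLC _ e (by simp)
    rintro rfl
    simp at hnd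
  | trans h1 h2 ih1 ih2 =>
    rw [ih1 hnd C hLC, ih2 (h1.nodup_iff.1 hnd) C fun c hc e => hLC c hc (h1.mem_iff.2 e)]

end Abstract

/-! ### Multiplication of bracket sums by parts of Dunkl elements. -/

section Abstract

variable {ι R : Type*} [Ring R]
variable {br : ι → ι → R} {x : ι → R} {t : R} {q : ι → ι → R} {Y : Finset ι → R}

/-- The part `x_v + ∑_{j ∈ L} [v,j]` of a Dunkl element. -/
def partialDunkl (br : ι → ι → R) (x : ι → R) (L : List ι) (v : ι) : R :=
  x v + (L.map (br v)).sum

theorem partialDunkl_cons (br : ι → ι → R) (x : ι → R) (j : ι) (L : List ι) (v : ι) :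
    partialDunkl br x (j :: L) v = partialDunkl br x L v + br v j := by
  simp only [partialDunkl, List.map_cons, List.sum_cons]
  abel

theorem ExtRelations.commute_partialDunkl (h : ExtRelations br x t q) {a b v : ι} {L : List ι}
    (hav : a ≠ v) (hbv : b ≠ v) (ha : a ∉ L) (hb : b ∉ L) :
    Commute (br a b) (partialDunkl br x L v) := by
  refine (h.br_x a b v hav.symm hbv.symm).add_right ?_
  induction L with
  | nil => simp
  | cons j L ih =>
    simp only [List.mem_cons, not_or] at ha hb
    rw [List.map_cons, List.sum_cons]
    exact (h.comm a b v j hav ha.1 hbv hb.1).add_right (ih ha.2 hb.2)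

variable [DecidableEq ι]

/-- Carrying [v,a] through the matching sum on (C \ {a}) ∪ {v} turns x_v into x_a and releases t Y(C
\ {a}). Summed over a, the released terms cancel the matched pairs {v,a} in the recursion for Y(C ∪
{v}). -/
theorem matchingSum_mul_partialDunkl (h : ExtRelations br x t q) (hY : IsMatchingSum x t Y)
    (v : ι) (C : Finset ι) (hv : v ∉ C) :
    Y C * (x v + ∑ a ∈ C, br v a) =
      Y (insert v C) + ∑ a ∈ C, br v a * Y (insert v (C.erase a)) := by
  have ha : ∀ a ∈ C, br v a * Y (insert v (C.erase a)) = Y C * br v a + t * Y (C.erase a) := by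
    intro a ha
    have hvC : v ∉ C.erase a := fun e => hv (Finset.mem_of_mem_erase e)
    have hc : ∀ s ⊆ C.erase a, Commute (br v a) (Y s) := fun s hs =>
      hY.commute (h.t_br v a).symm s fun c hc => h.br_x v a c
        (fun e => hvC (e ▸ hs hc)) fun e => Finset.notMem_erase a C (e ▸ hs hc)
    have hS : Commute (br v a) (∑ b ∈ C.erase a, Y ((C.erase a).erase b)) :=
      Commute.sum_right _ _ _ fun b hb => hc _ (Finset.erase_subset b _)
    have hYC := hY.2 (C.erase a) a (Finset.notMem_erase a C)
    rw [Finset.insert_erase ha] at hYC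
    rw [hY.2 _ v hvC, hYC, sub_mul, mul_sub, mul_assoc (x a), ← (hc _ subset_rfl).eq, mul_assoc t,
      ← hS.eq, ← mul_assoc (br v a), ← mul_assoc (br v a),
      h.br_x_left v a fun e => hv (e ▸ ha), ← (h.t_br v a).eq]
    noncomm_ring
  have hx : Commute (x v) (Y C) := hY.commute (h.t_x v).symm C fun c _ => h.x_x v c
  rw [Finset.sum_congr rfl ha, Finset.sum_add_distrib, hY.2 C v hv, mul_add, ← hx.eq,
    Finset.mul_sum, Finset.mul_sum]
  abel

/-- Multiplication by the part of the Dunkl element of `v` that is visible to a bracket sum. -/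
theorem bracketSum_mul_partialDunkl (h : ExtRelations br x t q) (hY : IsMatchingSum x t Y)
    (v : ι) (L : List ι) (hL : L.Nodup) (hvL : v ∉ L) (C : Finset ι) (hv : v ∉ C)
    (hLC : ∀ c ∈ C, c ∉ L) :
    bracketSum br Y L C * (partialDunkl br x L v + ∑ a ∈ C, br v a) =
      bracketSum br Y L (insert v C)
        + ∑ a ∈ C, br v a * bracketSum br Y L (insert v (C.erase a)) := by
  induction L generalizing C with
  | nil =>
    simp only [bracketSum_nil, partialDunkl, List.map_nil, List.sum_nil, add_zero]
    exact matchingSum_mul_partialDunkl h hY v C hv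
  | cons j L ihL =>
    obtain ⟨hjL, hL⟩ := List.nodup_cons.1 hL
    obtain ⟨hvj, hvL⟩ := not_or.1 (mt List.mem_cons.2 hvL)
    induction C using Finset.strongInduction with
    | _ C ih =>
    have hjC : j ∉ C := fun e => hLC j e List.mem_cons_self
    have hLC' : ∀ c ∈ C, c ∉ L := fun c hc e => hLC c hc (List.mem_cons_of_mem j e)
    have h0 := ihL hL hvL C hv hLC'
    set p := bracketSum br Y (j :: L) with hp
    set p0 := bracketSum br Y L with hp0
    have hcons : ∀ C, p C = p0 C + ∑ c ∈ C, p (C.erase c) * br c j := bracketSum_cons br Y j L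
    -- the recursion for a set that contains `v`
    have hins : ∀ C, v ∉ C → p (insert v C) = p0 (insert v C) + p C * br v j
        + ∑ c ∈ C, p (insert v (C.erase c)) * br c j := by
      intro C hv
      rw [hcons (insert v C), Finset.sum_insert hv, Finset.erase_insert hv, add_assoc]
      congr 2
      refine Finset.sum_congr rfl fun c hc => ?_
      rw [Finset.erase_insert_of_ne (by rintro rfl; exact hv hc)]
    -- The last factor [c,j] passes the part of the Dunkl element that omits [v,c], except for the
    -- term [c,j][v,j]; on [v,c] the three-term relation gives [c,j][v,c] = [v,j][c,j] + [v,c][v,j].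
    -- The two leftover kinds of terms are exactly those in which the inserted index v carries the
    -- last factor [v,j].
    have hc : ∀ c ∈ C, p (C.erase c) * br c j * (partialDunkl br x (j :: L) v + ∑ a ∈ C, br v a)
        = p (insert v (C.erase c)) * br c j
          + ∑ a ∈ C.erase c, br v a * p (insert v ((C.erase c).erase a)) * br c j
          + p (C.erase c) * br c j * br v j + br v c * p (C.erase c) * br v j := by
      intro c hc
      have hcj : c ≠ j := fun e => hjC (e ▸ hc)
      have hvc : v ≠ c := fun e => hv (e ▸ hc)
      have hvC : v ∉ C.erase c := fun e => hv (Finset.mem_of_mem_erase e)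
      have e1 := ih _ (Finset.erase_ssubset hc) hvC
        fun d hd => hLC d (Finset.mem_of_mem_erase hd)
      have e2 : Commute (br c j) (partialDunkl br x L v + ∑ a ∈ C.erase c, br v a) := by
        refine (h.commute_partialDunkl (Ne.symm hvc) (Ne.symm hvj) (hLC' c hc) hjL).add_right
          (Commute.sum_right _ _ _ fun a ha => ?_)
        exact h.comm c j v a (Ne.symm hvc) (Finset.ne_of_mem_erase ha).symm (Ne.symm hvj)
          fun e => hjC (e ▸ Finset.mem_of_mem_erase ha)
      have e3 : Commute (br v c) (p (C.erase c)) :=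
        h.commute_bracketSum hY v c (j :: L) _ hvC (Finset.notMem_erase c C)
          (by simp [hvj, hvL]) (hLC c hc)
      have e4 := h.br_mul_br hvc hvj hcj
      rw [h.antisymm c v] at e4
      rw [partialDunkl_cons] at e1 ⊢
      rw [← Finset.add_sum_erase C _ hc, ← Finset.sum_mul, ← add_mul, ← e1, e3.eq]
      have e5 : br c j * br v c = br v j * br c j + br v c * br v j := by
        rw [e4]
        noncomm_ring
      have e6 : br c j * (partialDunkl br x L v + br v j + (br v c + ∑ a ∈ C.erase c, br v a))
          = (partialDunkl br x L v + br v j + ∑ a ∈ C.erase c, br v a) * br c j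
            + br c j * br v j + br v c * br v j := by
        calc _ = br c j * (partialDunkl br x L v + ∑ a ∈ C.erase c, br v a) + br c j * br v j
              + br c j * br v c := by noncomm_ring
          _ = _ := by
            rw [e2.eq, e5]
            noncomm_ring
      rw [mul_assoc, e6]
      noncomm_ring
    rw [hcons C, add_mul, Finset.sum_mul, Finset.sum_congr rfl hc, partialDunkl_cons,
      add_right_comm (partialDunkl br x L v), mul_add, h0, hins C hv, hcons C]
    have ha : ∀ a ∈ C, br v a * p (insert v (C.erase a)) = br v a * p0 (insert v (C.erase a))
        + br v a * p (C.erase a) * br v j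
        + ∑ c ∈ C.erase a, br v a * p (insert v ((C.erase c).erase a)) * br c j := by
      intro a ha
      rw [hins _ fun e => hv (Finset.mem_of_mem_erase e), mul_add, mul_add, Finset.mul_sum]
      simp only [mul_assoc, Finset.erase_right_comm (a := a)]
    rw [Finset.sum_congr rfl ha]
    simp only [Finset.sum_add_distrib]
    rw [sum_sum_erase_comm, add_mul, Finset.sum_mul]
    abel

end Abstract

/-! ### The conjugation identity and the recursion in the index set. -/

section Abstract

variable {ι R : Type*} [Ring R] [DecidableEq ι]
variable {br : ι → ι → R} {x : ι → R} {t : R} {q : ι → ι → R} {Y : Finset ι → R}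

theorem sum_insert_erase {M : Type*} [AddCommMonoid M] {b : ι} {B : Finset ι} (hb : b ∉ B)
    (f : ι → Finset ι → M) : ∑ a ∈ insert b B, f a ((insert b B).erase a) =
      f b B + ∑ a ∈ B, f a (insert b (B.erase a)) := by
  rw [Finset.sum_insert hb, Finset.erase_insert hb]
  congr 1
  refine Finset.sum_congr rfl fun a ha => ?_
  rw [Finset.erase_insert_of_ne (by rintro rfl; exact hb ha)]

/-- Conjugated bracket sums satisfy a recursion in the set of indices. -/
theorem sum_br_mul_bracketSum_mul_br_insert (h : ExtRelations br x t q) (hY : IsMatchingSum x t Y)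
    (v : ι) (L : List ι) (hL : L.Nodup) (hvL : v ∉ L) (b : ι) (B : Finset ι) (hb : b ∉ B)
    (hbv : b ≠ v) (hbL : b ∉ L) (hv : v ∉ B) (hLB : ∀ c ∈ B, c ∉ L) :
    br b v * bracketSum br Y (v :: L) B * br b v
      + ∑ a ∈ B, br a v * bracketSum br Y (v :: L) (insert b (B.erase a)) * br a v =
    ∑ c ∈ B, br c b * (br b v * bracketSum br Y (v :: L) (B.erase c) * br b v
      + ∑ a ∈ B.erase c,
        br a v * bracketSum br Y (v :: L) (insert b ((B.erase c).erase a)) * br a v)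
    + (∑ a ∈ B, br a v * bracketSum br Y (v :: L) (B.erase a) * br a v)
      * (partialDunkl br x L b + ∑ c ∈ B, br b c)
    + q b v * bracketSum br Y L B := by
  set p := bracketSum br Y (v :: L) with hp
  have hbvL : b ∉ v :: L := by simp [hbv, hbL]
  -- The sum over B ∪ {b} with a removed is rewritten through multiplication by the Dunkl part of b,
  -- then conjugated by [a,v]. Only the term ending in [b,v] fails to pass [a,v]; the three-term
  -- relation, applied on each side, resolves it.
  have ha : ∀ a ∈ B, br a v * p (insert b (B.erase a)) * br a v
      = br a v * p (B.erase a) * br a v * (partialDunkl br x L b + ∑ c ∈ B, br b c)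
        + br a b * (br b v * p (B.erase a) * br b v) - br b v * (br a v * p (B.erase a)) * br b v
        + ∑ c ∈ B.erase a, br c b * (br a v * p (insert b ((B.erase a).erase c)) * br a v) := by
    intro a ha
    have hav : a ≠ v := by rintro rfl; exact hv ha
    have hab : a ≠ b := by rintro rfl; exact hb ha
    have hbC : b ∉ B.erase a := fun e => hb (Finset.mem_of_mem_erase e)
    have haC := Finset.notMem_erase a B
    have hC : ∀ c ∈ B.erase a, c ∉ v :: L := by
      intro c hc
      have hcB := Finset.mem_of_mem_erase hc
      refine List.not_mem_cons_of_ne_of_not_mem ?_ (hLB c hcB)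
      rintro rfl
      exact hv hcB
    have e1 := bracketSum_mul_partialDunkl h hY b (v :: L) (List.nodup_cons.2 ⟨hvL, hL⟩) hbvL
      (B.erase a) hbC hC
    rw [← hp, partialDunkl_cons] at e1
    have e2 : Commute (br a v) (partialDunkl br x L b + ∑ c ∈ B.erase a, br b c) := by
      refine (h.commute_partialDunkl hab hbv.symm (hLB a ha) hvL).add_right
        (Commute.sum_right _ _ _ fun c hc => ?_)
      exact h.comm a v b c hab (Finset.ne_of_mem_erase hc).symm hbv.symm
        fun e => hv (e ▸ Finset.mem_of_mem_erase hc)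
    have e3 : Commute (br a b) (p (B.erase a)) :=
      h.commute_bracketSum hY a b (v :: L) _ haC hbC
        (List.not_mem_cons_of_ne_of_not_mem hav (hLB a ha)) hbvL
    have e4 : br b v * br a v = br a b * br b v - br a v * br a b := h.br_mul_br hab.symm hbv hav
    have e5 : br a v * br a b = br a b * br b v - br b v * br a v := by
      rw [e4]
      abel
    have e6 : p (insert b (B.erase a)) = p (B.erase a) * (partialDunkl br x L b
        + ∑ c ∈ B.erase a, br b c) + p (B.erase a) * br b v
        + ∑ c ∈ B.erase a, br c b * p (insert b ((B.erase a).erase c)) := by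
      have e0 : ∑ c ∈ B.erase a, br b c * p (insert b ((B.erase a).erase c))
          = -∑ c ∈ B.erase a, br c b * p (insert b ((B.erase a).erase c)) := by
        rw [← Finset.sum_neg_distrib]
        exact Finset.sum_congr rfl fun c _ => by rw [h.antisymm b c, neg_mul]
      rw [e0, eq_add_neg_iff_add_eq] at e1
      rw [← e1]
      noncomm_ring
    have e7 : br a v * (∑ c ∈ B.erase a, br c b * p (insert b ((B.erase a).erase c))) * br a v
        = ∑ c ∈ B.erase a, br c b * (br a v * p (insert b ((B.erase a).erase c)) * br a v) := by
      rw [Finset.mul_sum, Finset.sum_mul]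
      refine Finset.sum_congr rfl fun c hc => ?_
      rw [← mul_assoc, (h.comm a v c b (Finset.ne_of_mem_erase hc).symm hab
        (fun e => hv (e ▸ Finset.mem_of_mem_erase hc)) hbv.symm).eq]
      simp only [mul_assoc]
    have e8 : br a v * (p (B.erase a) * br b v) * br a v
        = br a b * (br b v * p (B.erase a) * br b v) - br b v * (br a v * p (B.erase a)) * br b v
          - br a v * p (B.erase a) * br a v * br a b := by
      calc _ = br a v * p (B.erase a) * (br b v * br a v) := by simp only [mul_assoc]
        _ = br a v * (p (B.erase a) * br a b) * br b v
            - br a v * p (B.erase a) * br a v * br a b := by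
          rw [e4]
          noncomm_ring
        _ = _ := by
          rw [← e3.eq, ← mul_assoc (br a v) (br a b), e5]
          noncomm_ring
    rw [e6, mul_add, mul_add, add_mul, add_mul, e7, e8, ← Finset.add_sum_erase B _ ha,
      h.antisymm b a, mul_assoc (br a v), mul_assoc (p (B.erase a)), ← e2.eq]
    noncomm_ring
  -- Products without a factor [·,v] commute with [b,v], so conjugation produces [b,v]² = q_{bv}.
  -- The remaining sum cancels the negative term in `ha`.
  have hb2 : br b v * p B * br b v = q b v * bracketSum br Y L B
      + ∑ a ∈ B, br b v * (br a v * p (B.erase a)) * br b v := by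
    have e1 : Commute (br b v) (bracketSum br Y L B) := h.commute_bracketSum hY b v L B hb hv hbL hvL
    rw [hp, bracketSum_cons_left h hY v L hvL B hv hLB, mul_add, add_mul, mul_assoc, ← e1.eq,
      ← mul_assoc, h.sq b v hbv, Finset.mul_sum, Finset.sum_mul]
  generalize partialDunkl br x L b + ∑ c ∈ B, br b c = θ at ha ⊢
  rw [Finset.sum_congr rfl ha, hb2]
  simp only [Finset.sum_add_distrib, Finset.sum_sub_distrib, mul_add, Finset.mul_sum]
  rw [sum_sum_erase_comm]
  simp only [Finset.erase_right_comm, Finset.sum_mul]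
  abel

/-- The sums of bracket sums on the other side satisfy the same recursion. -/
theorem sum_q_mul_bracketSum_insert (h : ExtRelations br x t q) (hY : IsMatchingSum x t Y)
    (v : ι) (L : List ι) (hL : L.Nodup) (b : ι) (B : Finset ι) (hb : b ∉ B)
    (hbL : b ∉ L) (hLB : ∀ c ∈ B, c ∉ L) :
    q b v * bracketSum br Y (b :: L) B
      + ∑ a ∈ B, q a v * bracketSum br Y (a :: L) (insert b (B.erase a)) =
    ∑ c ∈ B, br c b * (q b v * bracketSum br Y (b :: L) (B.erase c)
      + ∑ a ∈ B.erase c, q a v * bracketSum br Y (a :: L) (insert b ((B.erase c).erase a)))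
    + (∑ a ∈ B, q a v * bracketSum br Y (a :: L) (B.erase a))
      * (partialDunkl br x L b + ∑ c ∈ B, br b c)
    + q b v * bracketSum br Y L B := by
  have ha : ∀ a ∈ B, q a v * bracketSum br Y (a :: L) (insert b (B.erase a))
      = q a v * bracketSum br Y (a :: L) (B.erase a)
          * (partialDunkl br x L b + ∑ c ∈ B, br b c)
        + ∑ c ∈ B.erase a,
          br c b * (q a v * bracketSum br Y (a :: L) (insert b ((B.erase a).erase c))) := by
    intro a ha
    have e1 := bracketSum_mul_partialDunkl h hY b (a :: L) (List.nodup_cons.2 ⟨hLB a ha, hL⟩)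
      (List.not_mem_cons_of_ne_of_not_mem (by rintro rfl; exact hb ha) hbL)
      (B.erase a) (fun e => hb (Finset.mem_of_mem_erase e)) (fun c hc =>
        List.not_mem_cons_of_ne_of_not_mem (Finset.ne_of_mem_erase hc)
          (hLB c (Finset.mem_of_mem_erase hc)))
    -- The head a of the list supplies the missing [b,a], so the sum runs over all of B.
    rw [partialDunkl_cons, add_assoc, Finset.add_sum_erase B _ ha] at e1
    rw [mul_assoc, e1, mul_add, Finset.mul_sum, add_assoc, ← Finset.sum_add_distrib,
      Finset.sum_eq_zero, add_zero]
    intro c hc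
    rw [← mul_assoc, (h.q_central a v (br b c)).eq, h.antisymm b c]
    noncomm_ring
  have hb2 : q b v * bracketSum br Y (b :: L) B = q b v * bracketSum br Y L B
      + ∑ c ∈ B, br c b * (q b v * bracketSum br Y (b :: L) (B.erase c)) := by
    rw [bracketSum_cons_left h hY b L hbL B hb hLB, mul_add, Finset.mul_sum]
    congr 1
    refine Finset.sum_congr rfl fun c hc => ?_
    rw [← mul_assoc, (h.q_central b v _).eq, mul_assoc]
  generalize partialDunkl br x L b + ∑ c ∈ B, br b c = θ at ha ⊢
  rw [Finset.sum_congr rfl ha, hb2]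
  simp only [Finset.sum_add_distrib, mul_add, Finset.mul_sum]
  rw [sum_sum_erase_comm]
  simp only [Finset.erase_right_comm, Finset.sum_mul]
  abel

/-- Both sides vanish on the empty set and satisfy the same recursion when an index b is added. That
recursion involves B itself and the sets of the same size as B that contain b, all smaller than B ∪
{b}, so strong induction on the cardinality applies. -/
theorem sum_br_mul_bracketSum_mul_br (h : ExtRelations br x t q) (hY : IsMatchingSum x t Y)
    (v : ι) (L : List ι) (hL : L.Nodup) (hvL : v ∉ L) (B : Finset ι)
    (hv : v ∉ B) (hLB : ∀ c ∈ B, c ∉ L) :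
    ∑ a ∈ B, br a v * bracketSum br Y (v :: L) (B.erase a) * br a v =
      ∑ a ∈ B, q a v * bracketSum br Y (a :: L) (B.erase a) := by
  induction hn : B.card using Nat.strong_induction_on generalizing B with
  | _ n ih =>
  subst hn
  rcases B.eq_empty_or_nonempty with rfl | ⟨b, hbB⟩
  · simp
  obtain ⟨B, hb, rfl⟩ : ∃ B', b ∉ B' ∧ insert b B' = B :=
    ⟨B.erase b, Finset.notMem_erase b B, Finset.insert_erase hbB⟩
  have hcard := Finset.card_insert_of_notMem hb
  have hbv : b ≠ v := by rintro rfl; exact hv hbB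
  have hvB : v ∉ B := fun e => hv (Finset.mem_insert_of_mem e)
  have hLB' : ∀ c ∈ B, c ∉ L := fun c hc => hLB c (Finset.mem_insert_of_mem hc)
  have key : ∀ c ∈ B, br b v * bracketSum br Y (v :: L) (B.erase c) * br b v
      + ∑ a ∈ B.erase c,
        br a v * bracketSum br Y (v :: L) (insert b ((B.erase c).erase a)) * br a v
      = q b v * bracketSum br Y (b :: L) (B.erase c)
      + ∑ a ∈ B.erase c, q a v * bracketSum br Y (a :: L) (insert b ((B.erase c).erase a)) := by
    intro c hc
    have hsub : insert b (B.erase c) ⊆ insert b B :=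
      Finset.insert_subset_insert b (Finset.erase_subset c B)
    have hbc : b ∉ B.erase c := fun e => hb (Finset.mem_of_mem_erase e)
    have := ih _ (by
      rw [Finset.card_insert_of_notMem hbc, hcard]
      have := Finset.card_erase_lt_of_mem hc
      omega) (insert b (B.erase c)) (fun e => hv (hsub e)) (fun d hd => hLB d (hsub hd)) rfl
    rwa [sum_insert_erase hbc fun a s => br a v * bracketSum br Y (v :: L) s * br a v,
      sum_insert_erase hbc fun a s => q a v * bracketSum br Y (a :: L) s] at this
  rw [sum_insert_erase hb fun a s => br a v * bracketSum br Y (v :: L) s * br a v,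
    sum_insert_erase hb fun a s => q a v * bracketSum br Y (a :: L) s,
    sum_br_mul_bracketSum_mul_br_insert h hY v L hL hvL b B hb hbv (hLB b hbB) hvB hLB',
    sum_q_mul_bracketSum_insert h hY v L hL b B hb (hLB b hbB) hLB',
    ih B.card (by omega) B hvB hLB' rfl]
  congr 2
  refine Finset.sum_congr rfl fun c hc => ?_
  rw [key c hc]

/-- Moving an index from the list into the set. -/
theorem bracketSum_insert (h : ExtRelations br x t q) (hY : IsMatchingSum x t Y)
    (v : ι) (L : List ι) (hL : L.Nodup) (hvL : v ∉ L) (I : Finset ι) (hv : v ∉ I)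
    (hLI : ∀ c ∈ I, c ∉ L) :
    bracketSum br Y L (insert v I) =
      bracketSum br Y (v :: L) I * (partialDunkl br x L v + ∑ a ∈ I, br v a)
        + ∑ a ∈ I, q a v * bracketSum br Y (a :: v :: L) (I.erase a) := by
  induction I using Finset.strongInduction with
  | _ I ih =>
  have e1 := bracketSum_mul_partialDunkl h hY v L hL hvL I hv hLI
  have e2 := sum_br_mul_bracketSum_mul_br h hY v L hL hvL I hv hLI
  -- The induction hypothesis for I \ {a} accounts for all of the Dunkl part except [v,a] = -[a,v];
  -- this last term is what creates the conjugates.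
  have e3 : ∀ a ∈ I, br a v * bracketSum br Y (v :: L) (I.erase a)
        * (partialDunkl br x L v + ∑ c ∈ I, br v c)
      = br a v * bracketSum br Y L (insert v (I.erase a))
        - ∑ b ∈ I.erase a, br a v * (q b v * bracketSum br Y (b :: v :: L) ((I.erase a).erase b))
        - br a v * bracketSum br Y (v :: L) (I.erase a) * br a v := by
    intro a ha
    have := ih _ (Finset.erase_ssubset ha) (fun e => hv (Finset.mem_of_mem_erase e))
      fun c hc => hLI c (Finset.mem_of_mem_erase hc)
    rw [this, ← Finset.mul_sum, ← Finset.add_sum_erase I _ ha, h.antisymm v a]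
    noncomm_ring
  have e4 : ∀ a ∈ I, q a v * bracketSum br Y (a :: v :: L) (I.erase a)
      = q a v * bracketSum br Y (a :: L) (I.erase a) + ∑ b ∈ I.erase a,
        br b v * (q a v * bracketSum br Y (a :: v :: L) ((I.erase a).erase b)) := by
    intro a ha
    have hav : a ≠ v := by rintro rfl; exact hv ha
    have hs : ∀ s ⊆ I.erase a, bracketSum br Y (a :: v :: L) s = bracketSum br Y (v :: a :: L) s :=
      fun s hs => bracketSum_swap h a v hav L s (fun e => Finset.notMem_erase a I (hs e))
        fun e => hv (Finset.mem_of_mem_erase (hs e))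
    rw [hs _ subset_rfl, bracketSum_cons_left h hY v (a :: L)
      (List.not_mem_cons_of_ne_of_not_mem hav.symm hvL) _
      (fun e => hv (Finset.mem_of_mem_erase e)) (fun c hc =>
        List.not_mem_cons_of_ne_of_not_mem (Finset.ne_of_mem_erase hc)
          (hLI c (Finset.mem_of_mem_erase hc))), mul_add, Finset.mul_sum]
    congr 1
    refine Finset.sum_congr rfl fun b hb => ?_
    rw [hs _ (Finset.erase_subset _ _), ← mul_assoc, (h.q_central a v _).eq, mul_assoc]
  rw [bracketSum_cons_left h hY v L hvL I hv hLI, add_mul, e1, Finset.sum_mul,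
    Finset.sum_congr rfl e3, Finset.sum_congr rfl e4]
  simp only [Finset.sum_add_distrib, Finset.sum_sub_distrib]
  -- The conjugates become the terms q_{av} F(a :: L; I \ {a}) and cancel those produced by `e4`;
  -- the double sums cancel after exchanging a and b.
  rw [e2, sum_sum_erase_comm (C := I)
    (f := fun a b => br b v * (q a v * bracketSum br Y (a :: v :: L) ((I.erase a).erase b)))]
  have e5 : ∑ a ∈ I, br v a * bracketSum br Y L (insert v (I.erase a))
      = -∑ a ∈ I, br a v * bracketSum br Y L (insert v (I.erase a)) := by
    rw [← Finset.sum_neg_distrib]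
    exact Finset.sum_congr rfl fun a _ => by rw [h.antisymm v a, neg_mul]
  rw [e5]
  simp only [Finset.erase_right_comm]
  abel

end Abstract

/-! ### Shift by a central indeterminate; Hermite-type polynomials and the numbers N(a, 2b). -/

section Abstract

variable {ι R : Type*} [Ring R]

open Polynomial

/-- Adding a central indeterminate to the `x`'s preserves the relations. -/
theorem ExtRelations.shift {br : ι → ι → R} {x : ι → R} {t : R} {q : ι → ι → R}
    (h : ExtRelations br x t q) :
    ExtRelations (fun a b => (C (br a b) : R[X])) (fun a => C (x a) + X) (C t)
      fun a b => C (q a b) where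
  antisymm a b := by rw [h.antisymm a b, C_neg]
  sq a b hab := by rw [← C_mul, h.sq a b hab]
  comm a b c d h1 h2 h3 h4 := (h.comm a b c d h1 h2 h3 h4).map C
  cyclic a b c h1 h2 h3 := by
    simp only [← C_mul, ← C_add, h.cyclic a b c h1 h2 h3, C_0]
  br_x a b c h1 h2 := ((h.br_x a b c h1 h2).map C).add_right (commute_X (C (br a b))).symm
  br_x_left a b hab := by
    rw [mul_add, ← C_mul, h.br_x_left a b hab, add_mul, X_mul, C_add, C_mul]
    abel
  t_br a b := (h.t_br a b).map C
  t_x a := ((h.t_x a).map C).add_right (commute_X (C t)).symm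
  x_x a b := (((h.x_x a b).map C).add_right (commute_X (C (x a))).symm).add_left (commute_X _)
  q_central a b y := by
    induction y using Polynomial.induction_on' with
    | add p r hp hr => exact hp.add_right hr
    | monomial k r =>
      rw [← C_mul_X_pow_eq_monomial]
      exact ((h.q_central a b r).map C).mul_right ((commute_X (C (q a b))).symm.pow_right k)

variable [DecidableEq ι]

theorem map_bracketSum {A : Type*} [Ring A] (f : R →+* A) (br : ι → ι → R) (Y : Finset ι → R)
    (L : List ι) (C : Finset ι) : f (bracketSum br Y L C) =
      bracketSum (fun a b => f (br a b)) (fun C => f (Y C)) L C := by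
  induction L generalizing C with
  | nil => simp only [bracketSum_nil]
  | cons j L ihL =>
    induction C using Finset.strongInduction with
    | _ C ih =>
    rw [bracketSum_cons, bracketSum_cons, map_add, map_sum, ihL]
    congr 1
    refine Finset.sum_congr rfl fun c hc => ?_
    rw [map_mul, ih _ (Finset.erase_ssubset hc)]

theorem bracketSum_empty (br : ι → ι → R) (Y : Finset ι → R) (L : List ι) :
    bracketSum br Y L ∅ = Y ∅ := by
  induction L with
  | nil => exact bracketSum_nil br Y ∅
  | cons j L ih => rw [bracketSum_cons, ih, Finset.sum_empty, add_zero]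

theorem sum_powerset_erase_comm {M : Type*} [AddCommMonoid M] (I : Finset ι)
    (f : ι → Finset ι → M) :
    ∑ a ∈ I, ∑ B ∈ (I.erase a).powerset, f a B = ∑ B ∈ I.powerset, ∑ a ∈ I \ B, f a B :=
  Finset.sum_comm' fun a B => by
    simp only [Finset.mem_powerset, Finset.mem_sdiff, Finset.subset_erase]
    tauto

/-- Bracket sums in terms of those for the indicator function of the empty set. -/
theorem bracketSum_eq_sum_powerset (br : ι → ι → R) (Y : Finset ι → R) (L : List ι)
    (I : Finset ι) : bracketSum br Y L I =
      ∑ B ∈ I.powerset, Y B * bracketSum br (fun C => if C = ∅ then 1 else 0) L (I \ B) := by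
  induction L generalizing I with
  | nil =>
    simp only [bracketSum_nil]
    rw [Finset.sum_eq_single_of_mem I (Finset.mem_powerset_self I)]
    · simp
    · intro B hB hBI
      rw [if_neg, mul_zero]
      rw [Finset.sdiff_eq_empty_iff_subset]
      exact fun h => hBI ((Finset.mem_powerset.1 hB).antisymm h)
  | cons j L ihL =>
    induction I using Finset.strongInduction with
    | _ I ih =>
    have h1 : ∀ a ∈ I, bracketSum br Y (j :: L) (I.erase a) * br a j
        = ∑ B ∈ (I.erase a).powerset, Y B * (bracketSum br (fun C => if C = ∅ then 1 else 0)
            (j :: L) ((I \ B).erase a) * br a j) := by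
      intro a ha
      rw [ih _ (Finset.erase_ssubset ha), Finset.sum_mul]
      refine Finset.sum_congr rfl fun B _ => ?_
      rw [mul_assoc, Finset.erase_sdiff_comm]
    rw [bracketSum_cons, ihL, Finset.sum_congr rfl h1, sum_powerset_erase_comm,
      ← Finset.sum_add_distrib]
    refine Finset.sum_congr rfl fun B _ => ?_
    rw [← Finset.mul_sum, ← mul_add, ← bracketSum_cons]

/-- The sum of `X^a (-t)^b` over the partial matchings of a set of `a + 2b` elements, with `b` the
number of pairs. -/
noncomputable def hermite (t : R) : ℕ → R[X]
  | 0 => 1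
  | 1 => X
  | p + 2 => X * hermite t (p + 1) - C t * (((p + 1 : ℕ) : R[X]) * hermite t p)

/-- For p = 0 the truncated index p - 1 does no harm, because its coefficient p vanishes. -/
theorem hermite_succ (t : R) (p : ℕ) :
    hermite t (p + 1) = X * hermite t p - C t * ((p : R[X]) * hermite t (p - 1)) := by
  rcases p with _ | p
  · simp [hermite]
  · rw [hermite, Nat.add_sub_cancel]

theorem pieriN_zero (a : ℕ) : pieriN a 0 = 1 := by simp [pieriN]

theorem pieriN_zero_succ (b : ℕ) : pieriN 0 (b + 1) = (2 * b + 1) * pieriN 0 b := by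
  rcases b with _ | b
  · simp [pieriN]
  · simp only [pieriN, zero_add, Nat.choose_self, mul_one]
    exact Nat.doubleFactorial_add_two (2 * b + 1)

/-- N(a, 2b) counts the matchings of a + 2b points with b pairs. A chosen point is either unmatched
or paired with one of the a + 2b + 2 others. -/
theorem pieriN_succ_succ (a b : ℕ) : pieriN (a + 1) (b + 1) =
    pieriN a (b + 1) + (a + 2 * b + 2) * pieriN (a + 1) b := by
  have h1 : Nat.doubleFactorial (2 * (b + 1) - 1)
      = (2 * b + 1) * Nat.doubleFactorial (2 * b - 1) := by
    rcases b with _ | b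
    · simp
    · exact Nat.doubleFactorial_add_two (2 * b + 1)
  have h2 : (a + 1 + 2 * (b + 1)).choose (2 * (b + 1))
      = (a + 2 * (b + 1)).choose (2 * b + 1) + (a + 2 * (b + 1)).choose (2 * (b + 1)) := by
    rw [show a + 1 + 2 * (b + 1) = (a + 2 * (b + 1)) + 1 by ring,
      show 2 * (b + 1) = (2 * b + 1) + 1 by ring, Nat.choose_succ_succ]
  have h3 := Nat.add_one_mul_choose_eq (a + 1 + 2 * b) (2 * b)
  rw [pieriN, pieriN, pieriN, h1, h2]
  rw [show a + 2 * (b + 1) = a + 1 + 2 * b + 1 by ring]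
  linear_combination Nat.doubleFactorial (2 * b - 1) * h3.symm

theorem coeff_hermite_succ (t : R) (p i : ℕ) : (hermite t (p + 1)).coeff i =
    (if i = 0 then 0 else (hermite t p).coeff (i - 1))
      - t * ((p : R) * (hermite t (p - 1)).coeff i) := by
  rw [hermite_succ, coeff_sub, coeff_C_mul, coeff_natCast_mul]
  rcases i with _ | i <;> simp [coeff_X_mul]

theorem coeff_hermite_eq_zero (t : R) (p i : ℕ) (h : ∀ r, i + 2 * r ≠ p) :
    (hermite t p).coeff i = 0 := by
  induction p using Nat.strong_induction_on generalizing i with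
  | _ p ih =>
  rcases p with _ | p
  · have := h 0
    rw [hermite, coeff_one, if_neg (by omega)]
  have h1 : (if i = 0 then 0 else (hermite t p).coeff (i - 1)) = 0 := by
    split_ifs with hi
    · rfl
    · exact ih p p.lt_succ_self _ fun r hr => h r (by omega)
  have h2 : (p : R) * (hermite t (p - 1)).coeff i = 0 := by
    rcases p with _ | p
    · simp
    · rw [ih (p + 1 - 1) (by omega) i fun r hr => h (r + 1) (by omega), mul_zero]
  rw [coeff_hermite_succ, h1, h2, mul_zero, sub_zero]

theorem coeff_hermite_add (t : R) (i r : ℕ) :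
    (hermite t (i + 2 * r)).coeff i = (-t) ^ r * (pieriN i r : ℕ) := by
  induction hp : i + 2 * r using Nat.strong_induction_on generalizing i r with
  | _ p ih =>
  rcases p with _ | p
  · obtain rfl : i = 0 := by omega
    obtain rfl : r = 0 := by omega
    simp [hermite, pieriN_zero]
  rw [coeff_hermite_succ]
  rcases r with _ | r
  · obtain ⟨i, rfl⟩ : ∃ i', i = i' + 1 := ⟨p, by omega⟩
    obtain rfl : p = i := by omega
    have h0 := ih p p.lt_succ_self p 0 (by omega)
    rw [pieriN_zero] at h0 ⊢
    rw [coeff_hermite_eq_zero t (p - 1) (p + 1) (by omega), if_neg (by omega),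
      Nat.add_sub_cancel, h0, mul_zero, mul_zero, sub_zero]
  · have h1 : t * ((p : R) * (hermite t (p - 1)).coeff i)
        = -((-t) ^ (r + 1) * ((p * pieriN i r : ℕ) : R)) := by
      rw [ih (p - 1) (by omega) i r (by omega), ← mul_assoc (p : R), (Nat.cast_commute p _).eq,
        Nat.cast_mul, pow_succ']
      noncomm_ring
    rw [h1, sub_neg_eq_add]
    rcases i with _ | i
    · rw [if_pos rfl, zero_add, pieriN_zero_succ]
      congr 4
      omega
    · rw [if_neg (by omega), Nat.add_sub_cancel, ih p (by omega) i (r + 1) (by omega), ← mul_add,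
        ← Nat.cast_add, pieriN_succ_succ]
      congr 5
      omega

/-- Matching sums after adding an indeterminate to the `x`'s. -/
theorem isMatchingSum_shift {x : ι → R} {t : R} {f : Finset ι → R} (h0 : f ∅ = 1)
    (hf : ∀ B v, v ∉ B → f (insert v B) = x v * f B) (ht : ∀ B, Commute t (f B)) :
    IsMatchingSum (fun a => C (x a) + X) (C t)
      fun B => ∑ S ∈ B.powerset, C (f S) * hermite t (B \ S).card := by
  refine ⟨by simp [h0, hermite], fun B v hv => ?_⟩
  -- Here v is outside S: it contributes X or is paired with some a ∈ B \ S. When v belongs to S,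
  -- treated next, it contributes x_v.
  have h1 : ∀ S ∈ B.powerset, C (f S) * hermite t (insert v B \ S).card
      = X * (C (f S) * hermite t (B \ S).card)
        - C t * ∑ a ∈ B \ S, C (f S) * hermite t ((B.erase a) \ S).card := by
    intro S hS
    have hvS : v ∉ S := fun e => hv (Finset.mem_powerset.1 hS e)
    have h2 : ∀ a ∈ B \ S, C (f S) * hermite t ((B.erase a) \ S).card
        = C (f S) * hermite t ((B \ S).card - 1) := by
      intro a ha
      rw [Finset.erase_sdiff_comm, Finset.card_erase_of_mem ha]
    rw [Finset.sum_congr rfl h2, Finset.sum_const, Finset.insert_sdiff_of_notMem _ hvS,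
      Finset.card_insert_of_notMem fun e => hv (Finset.mem_sdiff.1 e).1, hermite_succ, mul_sub,
      ← mul_assoc, ← X_mul, ← mul_assoc (C (f S)), ← ((ht S).map C).eq, nsmul_eq_mul]
    simp only [mul_assoc]
    congr 2
    rw [← mul_assoc, ← mul_assoc, (Nat.cast_commute _ _).eq]
  have h2 : ∀ S ∈ B.powerset, C (f (insert v S)) * hermite t (insert v B \ insert v S).card
      = C (x v) * (C (f S) * hermite t (B \ S).card) := by
    intro S hS
    have hvS : v ∉ S := fun e => hv (Finset.mem_powerset.1 hS e)
    rw [hf S v hvS, C_mul, mul_assoc, Finset.insert_sdiff_insert, Finset.sdiff_insert_of_notMem hv]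
  dsimp only
  rw [Finset.sum_powerset_insert hv, Finset.sum_congr rfl h1, Finset.sum_congr rfl h2,
    sum_powerset_erase_comm, Finset.sum_sub_distrib, ← Finset.mul_sum, ← Finset.mul_sum,
    ← Finset.mul_sum]
  noncomm_ring

end Abstract

/-! ### Bracket sums as sums over pairs of sequences. -/

section Sequences

variable {ι R : Type*} [Ring R] [LinearOrder ι] [Fintype ι]

/-- The pairs of sequences `(i_1, …, i_l)`, `(j_1, …, j_l)` with distinct `i_a ∈ U`, with `j_a ∈ J`
and with `j_1 ≤ ⋯ ≤ j_l`. -/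
def sequencePairs (U J : Finset ι) (l : ℕ) : Finset ((Fin l → ι) × (Fin l → ι)) :=
  open Classical in
  Finset.univ.filter fun p =>
    Function.Injective p.1 ∧ (∀ a, p.1 a ∈ U) ∧ (∀ a, p.2 a ∈ J) ∧ Monotone p.2

theorem mem_sequencePairs {U J : Finset ι} {l : ℕ} {p : (Fin l → ι) × (Fin l → ι)} :
    p ∈ sequencePairs U J l ↔
      Function.Injective p.1 ∧ (∀ a, p.1 a ∈ U) ∧ (∀ a, p.2 a ∈ J) ∧ Monotone p.2 := by
  simp [sequencePairs]

theorem snoc_mem_sequencePairs {U J : Finset ι} {l : ℕ} {j a : ι} (hJ : ∀ i ∈ J, i < j)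
    {p : (Fin l → ι) × (Fin l → ι)} :
    ((Fin.snoc p.1 a, Fin.snoc p.2 j) : (Fin (l + 1) → ι) × (Fin (l + 1) → ι))
      ∈ sequencePairs U (insert j J) (l + 1) ↔
    a ∈ U ∧ p ∈ sequencePairs (U.erase a) (insert j J) l := by
  simp only [mem_sequencePairs, Fin.forall_fin_succ', Fin.snoc_castSucc, Fin.snoc_last,
    Finset.mem_erase]
  constructor
  · rintro ⟨h1, ⟨h2, h3⟩, ⟨h4, -⟩, h6⟩
    refine ⟨h3, ?_, fun i => ⟨fun e => ?_, h2 i⟩, h4, ?_⟩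
    · intro i i' h
      refine Fin.castSucc_injective l (h1 ?_)
      simpa only [Fin.snoc_castSucc] using h
    · refine (Fin.castSucc_lt_last i).ne (h1 ?_)
      simpa only [Fin.snoc_castSucc, Fin.snoc_last] using e
    · intro i i' h
      simpa only [Fin.snoc_castSucc] using h6 (Fin.castSucc_le_castSucc_iff.2 h)
  · rintro ⟨h1, h2, h3, h4, h5⟩
    refine ⟨?_, ⟨fun i => (h3 i).2, h1⟩, ⟨h4, Finset.mem_insert_self j J⟩, ?_⟩
    · intro i i'
      induction i using Fin.lastCases <;> induction i' using Fin.lastCases <;>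
        simp only [Fin.snoc_castSucc, Fin.snoc_last]
      · simp
      · exact fun e => absurd e.symm (h3 _).1
      · exact fun e => absurd e (h3 _).1
      · exact fun e => congrArg _ (h2 e)
    · intro i i' h
      induction i' using Fin.lastCases with
      | last =>
        induction i using Fin.lastCases with
        | last => exact le_rfl
        | cast i =>
          rw [Fin.snoc_castSucc, Fin.snoc_last]
          rcases Finset.mem_insert.1 (h4 i) with e | e
          · exact e.le
          · exact (hJ _ e).le
      | cast i' =>
        induction i using Fin.lastCases with
        | last => exact absurd h (Fin.castSucc_lt_last i').not_ge
        | cast i =>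
          rw [Fin.snoc_castSucc, Fin.snoc_castSucc]
          exact h5 (Fin.castSucc_le_castSucc_iff.1 h)

theorem mem_sequencePairs_and_last_ne {U J : Finset ι} {l : ℕ} {j : ι} (hJ : ∀ i ∈ J, i < j)
    {p : (Fin (l + 1) → ι) × (Fin (l + 1) → ι)} :
    p ∈ sequencePairs U (insert j J) (l + 1) ∧ ¬ p.2 (Fin.last l) = j ↔
      p ∈ sequencePairs U J (l + 1) := by
  simp only [mem_sequencePairs]
  constructor
  · rintro ⟨⟨h1, h2, h3, h4⟩, h5⟩
    have hlast := (Finset.mem_insert.1 (h3 (Fin.last l))).resolve_left h5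
    refine ⟨h1, h2, fun a => (Finset.mem_insert.1 (h3 a)).resolve_left ?_, h4⟩
    exact ((h4 (Fin.le_last a)).trans_lt (hJ _ hlast)).ne
  · rintro ⟨h1, h2, h3, h4⟩
    exact ⟨⟨h1, h2, fun a => Finset.mem_insert_of_mem (h3 a), h4⟩, (hJ _ (h3 _)).ne⟩

/-- The last j_l is the largest term. Either it is the new maximum j and the last factor can be
removed, or j does not occur at all. This matches `bracketSum_cons`. -/
theorem sum_sequencePairs_succ (br : ι → ι → R) (U J : Finset ι) (l : ℕ) (j : ι)
    (hJ : ∀ i ∈ J, i < j) :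
    ∑ p ∈ sequencePairs U (insert j J) (l + 1), (List.ofFn fun a => br (p.1 a) (p.2 a)).prod =
      ∑ p ∈ sequencePairs U J (l + 1), (List.ofFn fun a => br (p.1 a) (p.2 a)).prod
      + ∑ a ∈ U, (∑ p ∈ sequencePairs (U.erase a) (insert j J) l,
          (List.ofFn fun a => br (p.1 a) (p.2 a)).prod) * br a j := by
  classical
  rw [← Finset.sum_filter_not_add_sum_filter _ fun p => p.2 (Fin.last l) = j]
  congr 1
  · refine Finset.sum_congr ?_ fun _ _ => rfl
    ext p
    rw [Finset.mem_filter, mem_sequencePairs_and_last_ne hJ]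
  · simp only [Finset.sum_mul]
    rw [Finset.sum_sigma']
    refine Finset.sum_bij' (fun p _ => ⟨p.1 (Fin.last l), (Fin.init p.1, Fin.init p.2)⟩)
      (fun s _ => (Fin.snoc s.2.1 s.1, Fin.snoc s.2.2 j)) ?_ ?_ ?_ ?_ ?_
    · rintro ⟨f, g⟩ hp
      obtain ⟨hp, rfl⟩ := Finset.mem_filter.1 hp
      rw [Finset.mem_sigma]
      refine (snoc_mem_sequencePairs hJ).1 ?_
      simpa only [Fin.snoc_init_self] using hp
    · rintro ⟨a, p⟩ hp
      rw [Finset.mem_sigma] at hp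
      exact Finset.mem_filter.2 ⟨(snoc_mem_sequencePairs hJ).2 hp, by simp⟩
    · rintro ⟨f, g⟩ hp
      obtain ⟨hp, rfl⟩ := Finset.mem_filter.1 hp
      simp only [Fin.snoc_init_self]
    · rintro ⟨a, f, g⟩ hp
      simp only [Fin.snoc_last, Fin.init_snoc]
    · rintro ⟨f, g⟩ hp
      obtain ⟨hp, rfl⟩ := Finset.mem_filter.1 hp
      rw [List.ofFn_succ', List.concat_eq_append, List.prod_append, List.prod_singleton]
      rfl

theorem sum_sequencePairs_zero (br : ι → ι → R) (U J : Finset ι) :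
    ∑ p ∈ sequencePairs U J 0, (List.ofFn fun a => br (p.1 a) (p.2 a)).prod = 1 := by
  have : sequencePairs U J 0 = Finset.univ := by
    ext p
    simp [mem_sequencePairs, Function.injective_of_subsingleton, Subsingleton.monotone]
  simp [this]

/-- Bracket sums as sums over pairs of sequences. -/
theorem sum_powersetCard_bracketSum (br : ι → ι → R) (L : List ι) (hL : L.Pairwise (· > ·))
    (U : Finset ι) (l : ℕ) :
    ∑ C ∈ U.powersetCard l, bracketSum br (fun C => if C = ∅ then 1 else 0) L C =
      ∑ p ∈ sequencePairs U L.toFinset l, (List.ofFn fun a => br (p.1 a) (p.2 a)).prod := by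
  induction L generalizing U l with
  | nil =>
    rcases l with _ | l
    · rw [sum_sequencePairs_zero]
      simp [bracketSum_nil]
    · rw [Finset.sum_eq_zero, Finset.sum_eq_zero]
      · intro p hp
        exact absurd ((mem_sequencePairs.1 hp).2.2.1 (Fin.last l)) (by simp)
      · intro C hC
        rw [bracketSum_nil, if_neg]
        rintro rfl
        simp at hC
  | cons j L ihL =>
    -- The list decreases, so its head is the largest second index, as splitting off the last factor
    -- of a weakly increasing sequence requires.
    obtain ⟨hj, hL⟩ := List.pairwise_cons.1 hL
    induction l generalizing U with
    | zero =>
      rw [sum_sequencePairs_zero]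
      simp [bracketSum_empty]
    | succ l ih =>
      rw [List.toFinset_cons, sum_sequencePairs_succ br U _ l j fun i hi => hj i (by simpa using hi),
        ← ihL hL, Finset.sum_congr rfl fun C _ => bracketSum_cons br _ j L C,
        Finset.sum_add_distrib, sum_powersetCard_sum_erase U l fun a C => bracketSum br
          (fun C => if C = ∅ then 1 else 0) (j :: L) C * br a j]
      congr 1
      refine Finset.sum_congr rfl fun a _ => ?_
      rw [← Finset.sum_mul, ih, List.toFinset_cons]

end Sequences

/-! ### Extraction of the coefficients of the shifted bracket sums. -/

section Coefficients

open Polynomial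

variable {ι R : Type*} [Ring R] [DecidableEq ι]

theorem coeff_hermite_eq_sum (t : R) (i k p : ℕ) (hp : p ≤ i + k) :
    (hermite t p).coeff i =
      ∑ r ∈ Finset.range (k + 1), if i + 2 * r = p then (-t) ^ r * (pieriN i r : R) else 0 := by
  by_cases h : ∃ r, i + 2 * r = p
  · obtain ⟨r, rfl⟩ := h
    rw [coeff_hermite_add, Finset.sum_eq_single_of_mem r (Finset.mem_range.2 (by omega)),
      if_pos rfl]
    exact fun s _ hs => if_neg (by omega)
  · push Not at h
    rw [coeff_hermite_eq_zero t p i h, Finset.sum_eq_zero]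
    exact fun r _ => if_neg (h r)

theorem sum_powerset_sum_powerset_sdiff {M : Type*} [AddCommMonoid M] (I : Finset ι)
    (f : Finset ι → Finset ι → M) :
    ∑ B ∈ I.powerset, ∑ S ∈ B.powerset, f S (I \ B) =
      ∑ S ∈ I.powerset, ∑ D ∈ (I \ S).powerset, f S D := by
  rw [Finset.sum_sigma', Finset.sum_sigma']
  refine Finset.sum_bij' (fun s _ => ⟨s.2, I \ s.1⟩) (fun s _ => ⟨I \ s.2, s.1⟩) ?_ ?_ ?_ ?_ ?_
  · rintro ⟨B, S⟩ h
    simp only [Finset.mem_sigma, Finset.mem_powerset] at h ⊢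
    exact ⟨h.2.trans h.1, Finset.sdiff_subset_sdiff subset_rfl h.2⟩
  · rintro ⟨S, D⟩ h
    simp only [Finset.mem_sigma, Finset.mem_powerset] at h ⊢
    exact ⟨Finset.sdiff_subset, Finset.subset_sdiff.2
      ⟨h.1, (Finset.subset_sdiff.1 h.2).2.symm⟩⟩
  · rintro ⟨B, S⟩ h
    simp only [Finset.mem_sigma, Finset.mem_powerset] at h
    simp only [Finset.sdiff_sdiff_eq_self h.1]
  · rintro ⟨S, D⟩ h
    simp only [Finset.mem_sigma, Finset.mem_powerset] at h
    simp only [Finset.sdiff_sdiff_eq_self (h.2.trans Finset.sdiff_subset)]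
  · intros
    rfl

/-- The coefficients of the bracket sums for the `x`'s shifted by an indeterminate. -/
theorem coeff_bracketSum_shift (br : ι → ι → R) (t : R) (f : Finset ι → R)
    (ht : ∀ B, Commute t (f B)) (L : List ι) (I : Finset ι) (i k : ℕ) (hik : i + k = I.card) :
    (bracketSum (fun a b => C (br a b))
        (fun B => ∑ S ∈ B.powerset, C (f S) * hermite t (B \ S).card) L I).coeff i =
      ∑ r ∈ Finset.range (k + 1), (-t) ^ r * (pieriN i r : R) * ∑ S ∈ I.powerset,
        ∑ l ∈ (Finset.range (k + 1)).filter (fun l => l + S.card + 2 * r = k),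
          f S * ∑ D ∈ (I \ S).powersetCard l,
            bracketSum br (fun D => if D = ∅ then 1 else 0) L D := by
  set F := bracketSum br (fun D => if D = ∅ then 1 else 0) L with hF
  have h1 : ∀ D, bracketSum (fun a b => (C (br a b) : R[X])) (fun D => if D = ∅ then 1 else 0) L D
      = C (F D) := by
    intro D
    rw [hF, map_bracketSum]
    simp only [apply_ite C, C_1, C_0]
  -- The Hermite index |B \ S| is written as |I \ S| - |I \ B| so that it depends only on S and on D
  -- = I \ B, the set of first indices of the brackets.
  have h2 : (bracketSum (fun a b => C (br a b))
        (fun B => ∑ S ∈ B.powerset, C (f S) * hermite t (B \ S).card) L I).coeff i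
      = ∑ B ∈ I.powerset, ∑ S ∈ B.powerset,
        f S * ((hermite t ((I \ S).card - (I \ B).card)).coeff i * F (I \ B)) := by
    rw [bracketSum_eq_sum_powerset, finsetSum_coeff]
    refine Finset.sum_congr rfl fun B hB => ?_
    rw [h1, coeff_mul_C, finsetSum_coeff, Finset.sum_mul]
    refine Finset.sum_congr rfl fun S hS => ?_
    rw [Finset.mem_powerset] at hB hS
    rw [coeff_C_mul, mul_assoc, Finset.card_sdiff_of_subset hS,
      Finset.card_sdiff_of_subset (hS.trans hB), Finset.card_sdiff_of_subset hB]
    have h3 := Finset.card_le_card hS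
    have h4 := Finset.card_le_card hB
    rw [show I.card - S.card - (I.card - B.card) = B.card - S.card by omega]
  -- With l = |D| and i + k = |I|, the condition l + |S| + 2r = k says that i + 2r points of I \ S
  -- remain outside D.
  have h3 : ∀ r, ∀ S ∈ I.powerset,
      ∑ l ∈ (Finset.range (k + 1)).filter (fun l => l + S.card + 2 * r = k),
        f S * ∑ D ∈ (I \ S).powersetCard l, F D
      = ∑ D ∈ (I \ S).powerset, if i + 2 * r = (I \ S).card - D.card then f S * F D else 0 := by
    intro r S hS
    rw [Finset.mem_powerset] at hS
    rw [← Finset.sum_filter]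
    simp only [Finset.mul_sum]
    rw [Finset.sum_sigma']
    refine Finset.sum_bij' (fun s _ => s.2) (fun D _ => ⟨D.card, D⟩) ?_ ?_ ?_ ?_ ?_
    all_goals have hS1 := Finset.card_le_card hS
    all_goals have hS2 := Finset.card_sdiff_of_subset hS
    · rintro ⟨l, D⟩ h
      simp only [Finset.mem_sigma, Finset.mem_filter, Finset.mem_range, Finset.mem_powersetCard,
        Finset.mem_powerset] at h ⊢
      exact ⟨h.2.1, by omega⟩
    · intro D h
      simp only [Finset.mem_sigma, Finset.mem_filter, Finset.mem_range, Finset.mem_powersetCard,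
        Finset.mem_powerset, and_true] at h ⊢
      have := Finset.card_le_card h.1
      exact ⟨⟨by omega, by omega⟩, h.1⟩
    · rintro ⟨l, D⟩ h
      simp only [Finset.mem_sigma, Finset.mem_powersetCard] at h
      simp only [h.2.2]
    · intros
      rfl
    · intros
      rfl
  rw [h2, sum_powerset_sum_powerset_sdiff I fun S D =>
    f S * ((hermite t ((I \ S).card - D.card)).coeff i * F D)]
  rw [Finset.sum_congr rfl fun r _ => congrArg _ (Finset.sum_congr rfl (h3 r))]
  simp only [Finset.mul_sum]
  rw [Finset.sum_comm (s := Finset.range (k + 1))]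
  refine Finset.sum_congr rfl fun S _ => ?_
  rw [Finset.sum_comm (s := Finset.range (k + 1))]
  refine Finset.sum_congr rfl fun D _ => ?_
  have h4 : (I \ S).card - D.card ≤ i + k := by
    have := Finset.card_le_card (Finset.sdiff_subset (s := I) (t := S))
    omega
  rw [coeff_hermite_eq_sum t i k _ h4, Finset.sum_mul, Finset.mul_sum]
  refine Finset.sum_congr rfl fun r _ => ?_
  split_ifs
  · have h5 : Commute (f S) ((-t) ^ r * (pieriN i r : R)) :=
      (((ht S).neg_left.pow_left r).symm).mul_right (Nat.commute_cast _ _)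
    rw [← mul_assoc, h5.eq, mul_assoc]
  · simp

end Coefficients

/-! ### Application to the extended quadratic algebra and its Dunkl elements. -/

section Algebra

open Polynomial

variable {K : Type*} [CommRing K] {n : ℕ} (q : Sym2 (Fin n) → K)

theorem extRelations : ExtRelations (br q) (x q) (t q)
    fun a b => algebraMap K (ExtAlg q) (q s(a, b)) where
  antisymm := br_antisymm q
  sq a b h := by
    have h1 := mk_rel q (Rel.sq a b h)
    rw [map_pow, AlgHom.commutes, sq] at h1
    rw [br, dif_pos h]
    exact h1
  comm := br_br_commute q
  cyclic := br_cyclic q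
  br_x := br_x_commute q
  br_x_left a b h := by
    rcases lt_or_gt_of_ne h with h | h
    · have h1 := mk_rel q (Rel.br_x_left a b h)
      rw [map_add, map_mul, map_mul] at h1
      rw [br, dif_pos h.ne]
      exact h1
    -- For a > b, antisymmetry turns the relation with -t into the one with +t, so one order-free
    -- relation covers both cases.
    · have h1 := mk_rel q (Rel.br_x_right b a h)
      rw [map_sub, map_mul, map_mul] at h1
      have h2 : br q b a * x q a = x q b * br q b a - t q := by
        rw [br, dif_pos h.ne]
        exact h1
      rw [br_antisymm q a b, neg_mul, h2]
      noncomm_ring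
  t_br a b := by
    by_cases h : a = b
    · simp [br, h]
    · have h1 := mk_rel q (Rel.br_t a b h)
      rw [map_mul, map_mul] at h1
      rw [br, dif_pos h]
      exact h1.symm
  t_x a := by
    have h1 := mk_rel q (Rel.x_t a)
    rw [map_mul, map_mul] at h1
    exact h1.symm
  x_x := x_commute q
  q_central a b y := Algebra.commutes _ y

theorem xProd_empty : xProd q ∅ = 1 := Finset.noncommProd_empty _ _

theorem xProd_insert (B : Finset (Fin n)) (v : Fin n) (hv : v ∉ B) :
    xProd q (insert v B) = x q v * xProd q B := Finset.noncommProd_insert_of_notMem _ _ _ _ hv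

theorem t_commute_xProd (S : Finset (Fin n)) : Commute (t q) (xProd q S) :=
  Finset.noncommProd_commute _ _ _ _ fun a _ => (extRelations q).t_x a

/-- The generating polynomial, in the number of unused indices of `I`, of the right-hand sides of
the Pieri formulas for `I`. -/
noncomputable def pieriPoly (I : Finset (Fin n)) : (ExtAlg q)[X] :=
  bracketSum (fun a b => C (br q a b))
    (fun B => ∑ S ∈ B.powerset, C (xProd q S) * hermite (t q) (B \ S).card) Iᶜ.toList I

theorem pieriPoly_empty : pieriPoly q ∅ = 1 := by
  rw [pieriPoly, bracketSum_empty]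
  simp [xProd_empty, hermite]

theorem isMatchingSum_xProd : IsMatchingSum (fun a => C (x q a) + X) (C (t q))
    fun B => ∑ S ∈ B.powerset, C (xProd q S) * hermite (t q) (B \ S).card :=
  isMatchingSum_shift (xProd_empty q) (xProd_insert q) (t_commute_xProd q)

/-- The generating polynomial from any enumeration of the complement of `I`. -/
theorem pieriPoly_eq (I : Finset (Fin n)) (L : List (Fin n)) (hL : L.Nodup)
    (h : ∀ a, a ∈ L ↔ a ∉ I) : pieriPoly q I = bracketSum (fun a b => C (br q a b))
      (fun B => ∑ S ∈ B.powerset, C (xProd q S) * hermite (t q) (B \ S).card) L I := by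
  refine bracketSum_perm (extRelations q).shift ?_ (Finset.nodup_toList _) I (by simp)
  rw [List.perm_ext_iff_of_nodup (Finset.nodup_toList _) hL]
  simp [h]

/-- Take `L` to enumerate the complement of I ∪ {v} in `bracketSum_insert`. Then L and I together
contain every index except v, so the partial Dunkl element completes to θ_v + X. -/
theorem pieriPoly_insert (I : Finset (Fin n)) (v : Fin n) (hv : v ∉ I) :
    pieriPoly q (insert v I) = pieriPoly q I * (C (dunkl q v) + X)
      + ∑ a ∈ I, C (algebraMap K (ExtAlg q) (q s(a, v))) * pieriPoly q (I.erase a) := by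
  set L := ((insert v I)ᶜ).toList with hLdef
  have hL : L.Nodup := Finset.nodup_toList _
  have hmem : ∀ a, a ∈ L ↔ a ≠ v ∧ a ∉ I := fun a => by simp [hLdef]
  have hvL : v ∉ L := fun e => ((hmem v).1 e).1 rfl
  have hdisj : ∀ c ∈ I, c ∉ L := fun c hc e => ((hmem c).1 e).2 hc
  have h1 : partialDunkl (fun a b => C (br q a b)) (fun a => C (x q a) + X) L v
      + ∑ a ∈ I, C (br q v a) = C (dunkl q v) + X := by
    have h2 : Finset.univ.filter (fun j => j ≠ v) = L.toFinset ∪ I := by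
      ext a
      simp only [Finset.mem_filter, Finset.mem_univ, true_and, Finset.mem_union,
        List.mem_toFinset, hmem]
      by_cases ha : a ∈ I
      · simp only [ha, or_true, iff_true]
        rintro rfl
        exact hv ha
      · simp [ha]
    have h3 : Disjoint L.toFinset I := by
      rw [Finset.disjoint_right]
      exact fun c hc => by simpa using hdisj c hc
    rw [dunkl, h2, Finset.sum_union h3, List.sum_toFinset _ hL, partialDunkl]
    simp only [map_add, map_sum, map_list_sum, List.map_map, Function.comp_def]
    abel
  rw [pieriPoly, bracketSum_insert (extRelations q).shift (isMatchingSum_xProd q) v L hL hvL I hv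
    hdisj, h1, pieriPoly_eq q I (v :: L) (List.nodup_cons.2 ⟨hvL, hL⟩)]
  · congr 1
    refine Finset.sum_congr rfl fun a ha => ?_
    have hav : a ≠ v := by
      rintro rfl
      exact hv ha
    rw [pieriPoly_eq q (I.erase a) (a :: v :: L)]
    · refine List.nodup_cons.2 ⟨?_, List.nodup_cons.2 ⟨hvL, hL⟩⟩
      exact List.not_mem_cons_of_ne_of_not_mem hav (hdisj a ha)
    · intro c
      simp only [List.mem_cons, hmem, Finset.mem_erase]
      by_cases hc : c = v <;> by_cases hc' : c = a <;> simp_all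
  · intro c
    simp only [List.mem_cons, hmem]
    by_cases hc : c = v <;> simp_all

theorem quantumElem_eq_zero (I : Finset (Fin n)) (k : ℕ) (h : I.card < k) :
    quantumElem q I k = 0 := by
  induction hc : I.card using Nat.strong_induction_on generalizing I k with
  | _ c ih =>
  subst hc
  obtain ⟨k, rfl⟩ : ∃ k', k = k' + 1 := ⟨k - 1, by omega⟩
  rcases I.eq_empty_or_nonempty with rfl | ⟨v, hvI⟩
  · exact quantumElem_empty q k
  obtain ⟨I, hv, rfl⟩ : ∃ I', v ∉ I' ∧ insert v I' = I :=
    ⟨I.erase v, Finset.notMem_erase v I, Finset.insert_erase hvI⟩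
  have hcard := Finset.card_insert_of_notMem hv
  obtain ⟨k, rfl⟩ : ∃ k', k = k' + 1 := ⟨k - 1, by omega⟩
  rw [quantumElem_insert q I v hv, ih I.card (by omega) I _ (by omega) rfl,
    ih I.card (by omega) I _ (by omega) rfl, Finset.sum_eq_zero]
  · simp
  · intro a ha
    have := Finset.card_erase_lt_of_mem ha
    rw [ih (I.erase a).card (by omega) _ _ (by omega) rfl, mul_zero]

/-- This plays the role of the convention e_k = 0 for k < 0 when coefficients are compared. -/
theorem coeff_pieriPoly_eq_zero (I : Finset (Fin n)) (i : ℕ) (hi : I.card < i) :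
    (pieriPoly q I).coeff i = 0 := by
  induction hc : I.card using Nat.strong_induction_on generalizing I i with
  | _ c ih =>
  subst hc
  obtain ⟨i, rfl⟩ : ∃ i', i = i' + 1 := ⟨i - 1, by omega⟩
  rcases I.eq_empty_or_nonempty with rfl | ⟨v, hvI⟩
  · rw [pieriPoly_empty, coeff_one, if_neg (by omega)]
  obtain ⟨I, hv, rfl⟩ : ∃ I', v ∉ I' ∧ insert v I' = I :=
    ⟨I.erase v, Finset.notMem_erase v I, Finset.insert_erase hvI⟩
  have hcard := Finset.card_insert_of_notMem hv
  rw [pieriPoly_insert q I v hv, coeff_add, mul_add, coeff_add, coeff_mul_C, coeff_mul_X,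
    ih I.card (by omega) I _ (by omega) rfl, ih I.card (by omega) I _ (by omega) rfl,
    finsetSum_coeff, Finset.sum_eq_zero]
  · simp
  · intro a ha
    have := Finset.card_erase_lt_of_mem ha
    rw [coeff_C_mul, ih (I.erase a).card (by omega) _ _ (by omega) rfl, mul_zero]

/-- In the recursion for P(I ∪ {v}), the factor X leaves k unchanged, the factor θ_v lowers it to k
- 1, and removing a lowers it to k - 2. These are the three terms of the recursion for e_k. -/
theorem coeff_pieriPoly (I : Finset (Fin n)) (i k : ℕ) (hik : i + k = I.card) :
    (pieriPoly q I).coeff i = dunklEval q (quantumElem q I k) := by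
  induction hc : I.card using Nat.strong_induction_on generalizing I i k with
  | _ c ih =>
  subst hc
  rcases I.eq_empty_or_nonempty with rfl | ⟨v, hvI⟩
  · rw [Finset.card_empty] at hik
    obtain rfl : i = 0 := by omega
    obtain rfl : k = 0 := by omega
    rw [pieriPoly_empty, quantumElem_zero, map_one, coeff_one_zero]
  obtain ⟨I, hv, rfl⟩ : ∃ I', v ∉ I' ∧ insert v I' = I :=
    ⟨I.erase v, Finset.notMem_erase v I, Finset.insert_erase hvI⟩
  have hcard := Finset.card_insert_of_notMem hv
  have hX : (pieriPoly q I * X).coeff i = dunklEval q (quantumElem q I k) := by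
    rcases i with _ | i
    -- At i = 0 one has k = |I| + 1, beyond the range where e_k(I) can be nonzero.
    · rw [mul_coeff_zero, coeff_X_zero, mul_zero, quantumElem_eq_zero q I k (by omega), map_zero]
    · rw [coeff_mul_X, ih I.card (by omega) I i k (by omega) rfl]
  rw [pieriPoly_insert q I v hv, mul_add, coeff_add, coeff_add, coeff_mul_C, hX, finsetSum_coeff]
  simp only [coeff_C_mul]
  have hs : ∀ a ∈ I, (I.erase a).card + 1 = I.card := fun a ha => Finset.card_erase_add_one ha
  rcases k with _ | _ | k
  · rw [coeff_pieriPoly_eq_zero q I i (by omega), Finset.sum_eq_zero, quantumElem_zero,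
      quantumElem_zero]
    · simp
    · intro a ha
      rw [coeff_pieriPoly_eq_zero q _ i (by have := hs a ha; omega), mul_zero]
  · rw [ih I.card (by omega) I i 0 (by omega) rfl, Finset.sum_eq_zero,
      quantumElem_insert_one q I v hv, map_add, dunklEval_X, quantumElem_zero]
    · simp [add_comm]
    · intro a ha
      rw [coeff_pieriPoly_eq_zero q _ i (by have := hs a ha; omega), mul_zero]
  -- The recursion for P places θ_v on the right. Reordering inside the polynomial ring before
  -- evaluation is where commutativity of the Dunkl elements enters.
  · rw [quantumElem_insert q I v hv, mul_comm (MvPolynomial.X v), map_add, map_add, map_mul,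
      dunklEval_X, map_sum, ih I.card (by omega) I i (k + 1) (by omega) rfl,
      add_comm (dunklEval q (quantumElem q I (k + 1)) * dunkl q v)]
    congr 1
    refine Finset.sum_congr rfl fun a ha => ?_
    have := hs a ha
    rw [ih (I.erase a).card (by omega) _ i k (by omega) rfl, map_mul, ← MvPolynomial.algebraMap_eq,
      AlgHom.commutes]

theorem pieriPairs_eq_sequencePairs (m : ℕ) (S : Finset (Fin n)) (l : ℕ) :
    pieriPairs n m S l = sequencePairs (initial n m \ S) (initial n m)ᶜ l := by
  ext p
  simp [pieriPairs, mem_sequencePairs]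

/-- The quantum Pieri formula over an arbitrary commutative ring. -/
theorem dunklEval_quantumElem_initial (m k : ℕ) (hkm : k ≤ m) (hmn : m ≤ n) :
    dunklEval q (quantumElem q (initial n m) k) =
      ∑ r ∈ Finset.range (k + 1), (-t q) ^ r * (pieriN (m - k) r : ℕ) *
        ∑ S ∈ (initial n m).powerset,
          ∑ l ∈ (Finset.range (k + 1)).filter (fun l => l + S.card + 2 * r = k),
            ∑ p ∈ pieriPairs n m S l,
              xProd q S * (List.ofFn fun a => br q (p.1 a) (p.2 a)).prod := by
  have hcard : (initial n m).card = m := by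
    rw [initial, Fin.card_filter_val_lt, min_eq_right hmn]
  have hL : ((initial n m)ᶜ.sort (· ≥ ·)).Pairwise (· > ·) :=
    ((initial n m)ᶜ.sortedGT_sort).pairwise
  rw [← coeff_pieriPoly q (initial n m) (m - k) k (by omega),
    pieriPoly_eq q _ ((initial n m)ᶜ.sort (· ≥ ·)) (Finset.sort_nodup _ _) (by simp),
    coeff_bracketSum_shift (br q) (t q) (xProd q) (t_commute_xProd q) _ _ _ k (by omega)]
  refine Finset.sum_congr rfl fun r _ => ?_
  congr 1
  refine Finset.sum_congr rfl fun S _ => Finset.sum_congr rfl fun l _ => ?_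
  rw [pieriPairs_eq_sequencePairs, ← Finset.mul_sum, sum_powersetCard_bracketSum _ _ hL,
    Finset.sort_toFinset]

end Algebra

end QuantumPieri

theorem theorem4p1 (n m k : ℕ) (hkm : k ≤ m) (hmn : m ≤ n) :
    QuantumPieri.dunklEval (QuantumPieri.qVar n)
        (QuantumPieri.quantumElem (QuantumPieri.qVar n) (QuantumPieri.initial n m) k) =
      ∑ r ∈ Finset.range (k + 1),
        (-QuantumPieri.t (QuantumPieri.qVar n)) ^ r * (QuantumPieri.pieriN (m - k) r : ℕ) *
          ∑ S ∈ (QuantumPieri.initial n m).powerset,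
            ∑ l ∈ (Finset.range (k + 1)).filter (fun l => l + S.card + 2 * r = k),
              ∑ p ∈ QuantumPieri.pieriPairs n m S l,
                QuantumPieri.xProd (QuantumPieri.qVar n) S *
                  (List.ofFn fun a =>
                    QuantumPieri.br (QuantumPieri.qVar n) (p.1 a) (p.2 a)).prod :=
  QuantumPieri.dunklEval_quantumElem_initial (QuantumPieri.qVar n) m k hkm hmn
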